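/- Let $\mathcal H$ be the upper half-plane, $q=e^{2\pi i\tau}$, $\theta(\tau)=\sum_{n\in\mathbb Z}q^{n^2}$, and $\eta(\tau)=q^{1/24}\prod_{n\ge1}(1-q^n)$ with $q^{1/24}=e^{\pi i\tau/12}$. For $k\ge0$, $4\mid N$ and a Dirichlet character $\chi$ modulo $N$, let $S_{k+1/2}(N,\chi)$ be Shimura's space of cusp forms of weight $k+\tfrac12$: holomorphic $f:\mathcal H\to\mathbb C$ that vanish at every cusp and satisfy $f(\gamma\tau)=\chi(d)\,\bigl(\theta(\gamma\tau)/\theta(\tau)\bigr)^{2k+1}f(\tau)$ for all $\gamma=\begin{pmatrix}a&b\\c&d\end{pmatrix}\in\Gamma_0(N)$. Vanishing at every cusp means that $(c\tau+d)^{-k-1/2}f(\gamma\tau)\to0$ as $\operatorname{Im}\tau\to\infty$ for every $\gamma\in SL_2(\mathbb Z)$. For a prime $\ell$ the Hecke operator $T(\ell^2)$ in weight $k+\tfrac12$ and character $\chi$ sends $f=\sum_{n\ge0}a(n)q^n$ to $f\mid T(\ell^2)=\sum_{n\ge0}c(n)q^n$, where $$c(n)=a(\ell^2n)+\chi(\ell)\left(\frac{(-1)^kn}{\ell}\right)\ell^{k-1}a(n)+\chi(\ell^2)\,\ell^{2k-1}a(n/\ell^2)$$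 and $a(n/\ell^2)=0$ if $\ell^2\nmid n$. Let $\chi_{12}(n)=1$ if $n\equiv\pm1\pmod{12}$, $\chi_{12}(n)=-1$ if $n\equiv\pm5\pmod{12}$, and $\chi_{12}(n)=0$ otherwise. For an integer $m\ge0$ let $M_m(1)$ be the space of modular forms of weight $m$ on $SL_2(\mathbb Z)$. **Proposition 3.1.** Let $1\le r\le23$ with $(r,6)=1$, let $m$ be an even nonnegative integer, let $\ell>3$ be a prime, and put $k=m+\tfrac{r-1}2$. Define $$\mathcal C_{r,k}:=\{\eta^r(24\tau)F(24\tau):F\in M_m(1)\}.$$ Then $\mathcal C_{r,k}\subset S_{r/2+m}(576,\chi_{12})$, and the Hecke operator $T(\ell^2)$ in weight $k+\tfrac12=\tfrac r2+m$ and character $\chi_{12}$ maps $\mathcal C_{r,k}$ into $\mathcal C_{r,k}$; in particular, for every $g\in\mathcal C_{r,k}$ the series defining $g\mid T(\ell^2)$ converges on $\mathcal H$. -/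

import Mathlib

open UpperHalfPlane hiding I
open scoped MatrixGroups Manifold

noncomputable section

namespace HalfIntegral

/-- The theta function `θ(τ) = ∑_{n ∈ ℤ} exp(2πi n² τ)`. Mathlib's `jacobiTheta τ` is
`∑_{n ∈ ℤ} exp(πi n² τ)`. -/
def theta (τ : ℍ) : ℂ := jacobiTheta (2 * (τ : ℂ))

/-- The transformation law of weight `k + 1/2` and character `χ` on `Γ₀(N)`, for `4 ∣ N`, in the
sense of Shimura: `f(γτ) = χ(d) j(γ, τ)^(2k+1) f(τ)` for `γ = (a b; c d) ∈ Γ₀(N)`, where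
`j(γ, τ) = θ(γτ) / θ(τ)` is the theta automorphy factor. The denominator is cleared; since `θ` has
no zeros on the upper half-plane, nothing is lost. -/
def IsThetaInvariant (k N : ℕ) (χ : DirichletCharacter ℂ N) (f : ℍ → ℂ) : Prop :=
  ∀ γ ∈ CongruenceSubgroup.Gamma0 N, ∀ τ : ℍ,
    theta τ ^ (2 * k + 1) * f (γ • τ) =
      χ ((γ 1 1 : ℤ) : ZMod N) * theta (γ • τ) ^ (2 * k + 1) * f τ

/-- The slash action `f ∣_{k+1/2} ξ = φ(τ)^(-2k-1) f(γτ)` of the pair `ξ = (γ, φ)`, where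
`γ = (a b; c d) ∈ SL₂(ℤ)` and `φ(τ) = (cτ + d)^(1/2)` (principal branch, which is holomorphic on
the upper half-plane). Any other `φ` with `φ(τ)² = s (cτ + d)`, `|s| = 1`, changes the result by a
constant factor of absolute value one. -/
def halfSlash (k : ℕ) (f : ℍ → ℂ) (γ : SL(2, ℤ)) (τ : ℍ) : ℂ :=
  ((((γ 1 0 : ℤ) : ℂ) * (τ : ℂ) + ((γ 1 1 : ℤ) : ℂ)) ^ (1 / 2 : ℂ)) ^ (-(2 * (k : ℤ) + 1)) *
    f (γ • τ)

/-- The space `S_{k+1/2}(N, χ)` (for `4 ∣ N`) of cusp forms of weight `k + 1/2` and character `χ`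
on `Γ₀(N)`: holomorphic functions on the upper half-plane with the transformation law above which
vanish at every cusp. The cusps are the points `γ∞` with `γ ∈ SL₂(ℤ)`. -/
def cuspForms (k N : ℕ) (χ : DirichletCharacter ℂ N) : Submodule ℂ (ℍ → ℂ) where
  carrier := {f | MDifferentiable 𝓘(ℂ) 𝓘(ℂ) f ∧ IsThetaInvariant k N χ f ∧
    ∀ γ : SL(2, ℤ), IsZeroAtImInfty (halfSlash k f γ)}
  add_mem' := by
    rintro f g ⟨hf₁, hf₂, hf₃⟩ ⟨hg₁, hg₂, hg₃⟩
    refine ⟨hf₁.add hg₁, fun γ hγ τ => ?_, fun γ => ?_⟩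
    · have h₁ := hf₂ γ hγ τ
      have h₂ := hg₂ γ hγ τ
      simp only [Pi.add_apply]
      linear_combination h₁ + h₂
    · have h : halfSlash k (f + g) γ = halfSlash k f γ + halfSlash k g γ := by
        funext τ
        simp only [halfSlash, Pi.add_apply, mul_add]
      rw [h]
      exact (hf₃ γ).add (hg₃ γ)
  zero_mem' := by
    refine ⟨mdifferentiable_const, fun γ hγ τ => by simp, fun γ => ?_⟩
    have h : halfSlash k 0 γ = 0 := by
      funext τ
      simp [halfSlash]
    rw [h]
    exact Filter.zero_zeroAtFilter _
  smul_mem' := by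
    rintro c f ⟨hf₁, hf₂, hf₃⟩
    refine ⟨hf₁.const_smul c, fun γ hγ τ => ?_, fun γ => ?_⟩
    · have h₁ := hf₂ γ hγ τ
      simp only [Pi.smul_apply, smul_eq_mul]
      linear_combination c * h₁
    · have h : halfSlash k (c • f) γ = c • halfSlash k f γ := by
        funext τ
        simp only [halfSlash, Pi.smul_apply, smul_eq_mul]
        ring
      rw [h]
      exact (hf₃ γ).smul c

/-- The coefficient `a(n)` of `q^n`, `q = exp(2πiτ)`, in the `q`-expansion of a (1-periodic)
function on the upper half-plane. -/
def qCoeff (f : ℍ → ℂ) (n : ℕ) : ℂ := (qExpansion 1 f).coeff n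

/-- The coefficient
`c(n) = a(ℓ²n) + χ(ℓ) ((-1)^k n / ℓ) ℓ^(k-1) a(n) + χ(ℓ²) ℓ^(2k-1) a(n/ℓ²)`
of `q^n` in `f ∣ T(ℓ²)`, for `f = ∑ a(n) q^n` of weight `k + 1/2` and character `χ`; here
`a(n/ℓ²) = 0` if `ℓ² ∤ n`. The exponents `k - 1` and `2k - 1` are integers, equal to `-1` if
`k = 0`. -/
def heckeCoeff (k : ℕ) {N : ℕ} (χ : DirichletCharacter ℂ N) (ℓ : ℕ) [Fact ℓ.Prime]
    (f : ℍ → ℂ) (n : ℕ) : ℂ :=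
  qCoeff f (ℓ ^ 2 * n) +
    χ (ℓ : ZMod N) * (legendreSym ℓ ((-1) ^ k * (n : ℤ)) : ℂ) * (ℓ : ℂ) ^ ((k : ℤ) - 1) *
      qCoeff f n +
    χ ((ℓ ^ 2 : ℕ) : ZMod N) * (ℓ : ℂ) ^ (2 * (k : ℤ) - 1) *
      (if ℓ ^ 2 ∣ n then qCoeff f (n / ℓ ^ 2) else 0)

/-- The Hecke operator `T(ℓ²)` in weight `k + 1/2` and character `χ`:
`f ∣ T(ℓ²) = ∑ c(n) q^n` with `q = exp(2πiτ)`. -/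
def hecke (k : ℕ) {N : ℕ} (χ : DirichletCharacter ℂ N) (ℓ : ℕ) [Fact ℓ.Prime]
    (f : ℍ → ℂ) (τ : ℍ) : ℂ :=
  ∑' n : ℕ, heckeCoeff k χ ℓ f n * Complex.exp (2 * Real.pi * Complex.I * (τ : ℂ)) ^ n

/-- The character modulo `12` with `χ₁₂(n) = 1` if `n ≡ ±1`, `χ₁₂(n) = -1` if `n ≡ ±5`, and
`χ₁₂(n) = 0` otherwise, with integer values. -/
def chi12Int : MulChar (ZMod 12) ℤ where
  toFun a := if a = 1 ∨ a = -1 then 1 else if a = 5 ∨ a = -5 then -1 else 0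
  map_one' := by decide
  map_mul' := by decide
  map_nonunit' := by decide

/-- The character `χ₁₂`, viewed as a Dirichlet character modulo `576`. -/
def chi12 : DirichletCharacter ℂ 576 :=
  DirichletCharacter.changeLevel (show 12 ∣ 576 by norm_num)
    (chi12Int.ringHomComp (Int.castRingHom ℂ))

/-- The point `24τ` of the upper half-plane. -/
def mul24 (τ : ℍ) : ℍ := ⟨24 * (τ : ℂ), by simpa using τ.im_pos⟩

/-- The space of functions `τ ↦ η(24τ)^r F(24τ)` with `F ∈ M_m(1)`, the modular forms of weight
`m` on `SL₂(ℤ)`. -/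
def etaSpace (r m : ℕ) : Submodule ℂ (ℍ → ℂ) where
  carrier := {g | ∃ F : ModularForm 𝒮ℒ (m : ℤ),
    ∀ τ : ℍ, g τ = ModularForm.eta (mul24 τ : ℂ) ^ r * F (mul24 τ)}
  add_mem' := by
    rintro f g ⟨F, hF⟩ ⟨G, hG⟩
    refine ⟨F + G, fun τ => ?_⟩
    simp only [Pi.add_apply, hF, hG, add_apply]
    ring
  zero_mem' := ⟨0, fun τ => by simp⟩
  smul_mem' := by
    rintro c f ⟨F, hF⟩
    refine ⟨c • F, fun τ => ?_⟩
    simp only [Pi.smul_apply, hF, smul_apply, smul_eq_mul]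
    ring

end HalfIntegral

end

/-!
By the pentagonal number theorem, `√12 η(12t) = Θ(1/12, t) - Θ(5/12, t)` for Jacobi's theta function
`Θ`. The transformation law of `Θ` under `Γ₀(576)` therefore gives `η(24τ)` and `θ(τ)` the same
automorphy factor up to `χ₁₂(d)`, which is the transformation law of `η(24τ)^r F(24τ)`. It vanishes
at the cusps because `η²⁴` is a cusp form of level one, and dilation by `24` preserves this.

Put `w = 24τ` and `h(w) = η(w)^r F(w)`. Then `T(ℓ²)` combines the shifts `h((w + 24b)/ℓ²)`, the
shifts of `h(w)` by `24v/ℓ` weighted by Legendre symbols, and the dilation `h(ℓ²w)`. The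
transformation law of `η` under the matrices `(24A, B; c, 24D)`, whose multiplier is a quadratic
Gauss sum modulo `c`, shows that `w ↦ -1/w` permutes these terms up to the automorphy factor of `h`.
Since `ℓ² ≡ 1 (mod 24)`, all exponents `n` in the expansion of `h ∣ T(ℓ²)` in powers of
`exp(2πiw/24)` are `≡ r (mod 24)`. Hence `r ≤ n` as `r ≤ 23`, and `(h ∣ T(ℓ²)) / η^r` is bounded at
`i∞` and invariant under `S` and `T`, that is, a modular form of level one.
-/

namespace HalfIntegral

open Complex hiding eta
open Filter Topology ModularForm

/-! ### Theta and eta functions -/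

section Pentagonal

variable {𝕜 : Type*} [NormedField 𝕜] {x : 𝕜}

lemma norm_prod_one_sub_pow_le (hx : ‖x‖ < 1) (k n : ℕ) :
    ‖∏ i ∈ Finset.range n, (1 - x ^ (k + i + 1))‖ ≤ Real.exp (1 - ‖x‖)⁻¹ := by
  have h0 := norm_nonneg x
  calc ‖∏ i ∈ Finset.range n, (1 - x ^ (k + i + 1))‖
      = ∏ i ∈ Finset.range n, ‖1 - x ^ (k + i + 1)‖ := norm_prod _ _
    _ ≤ ∏ i ∈ Finset.range n, (1 + ‖x‖ ^ i) := by
        refine Finset.prod_le_prod (fun _ _ => norm_nonneg _) fun i _ => ?_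
        refine (norm_sub_le _ _).trans ?_
        rw [norm_one, norm_pow]
        have := pow_le_pow_of_le_one h0 hx.le (show i ≤ k + i + 1 by omega)
        linarith
    _ ≤ Real.exp (∑ i ∈ Finset.range n, ‖x‖ ^ i) :=
        Real.prod_one_add_le_exp_sum _ fun i => pow_nonneg h0 i
    _ ≤ Real.exp (1 - ‖x‖)⁻¹ := by
        rw [Real.exp_le_exp, ← tsum_geometric_of_lt_one h0 hx]
        exact (summable_geometric_of_lt_one h0 hx).sum_le_tsum _ fun i _ => pow_nonneg h0 i

lemma norm_pow_mul_prod_one_sub_pow_le (hx : ‖x‖ < 1) (k n : ℕ) :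
    ‖x ^ ((k + 1) * n) * ∏ i ∈ Finset.range (n + 1), (1 - x ^ (k + i + 1))‖ ≤
      ‖x‖ ^ n * Real.exp (1 - ‖x‖)⁻¹ := by
  rw [norm_mul, norm_pow]
  gcongr ?_ * ?_
  · exact pow_le_pow_of_le_one (norm_nonneg x) hx.le (by nlinarith [Nat.zero_le (k * n)])
  · exact norm_prod_one_sub_pow_le hx k (n + 1)

lemma norm_pow_pentagonal_sub_le (hx : ‖x‖ < 1) (k : ℕ) :
    ‖(-1) ^ k * (x ^ pentagonal (-k) - x ^ pentagonal (k + 1))‖ ≤ 2 * ‖x‖ ^ k := by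
  have h (j : ℤ) (hj : (k : ℤ) ≤ pentagonal j) : ‖x‖ ^ pentagonal j ≤ ‖x‖ ^ k :=
    pow_le_pow_of_le_one (norm_nonneg x) hx.le (by exact_mod_cast hj)
  have h₁ := h (-k) (by nlinarith [two_mul_natCast_pentagonal_neg k])
  have h₂ := h (k + 1) (by nlinarith [two_mul_natCast_pentagonal (k + 1)])
  rw [norm_mul, norm_pow, norm_neg, norm_one, one_pow, one_mul]
  refine (norm_sub_le _ _).trans ?_
  rw [norm_pow, norm_pow]
  linarith

variable [CompleteSpace 𝕜]

lemma summable_pow_pentagonal_sub (hx : ‖x‖ < 1) :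
    Summable fun k : ℕ => (-1) ^ k * (x ^ pentagonal (-k) - x ^ pentagonal (k + 1)) :=
  .of_norm_bounded ((summable_geometric_of_lt_one (norm_nonneg x) hx).mul_left 2)
    (norm_pow_pentagonal_sub_le hx)

lemma multipliable_one_sub_pow_add (hx : ‖x‖ < 1) (k : ℕ) :
    Multipliable fun n => 1 - x ^ (n + k + 1) := by
  simp_rw [sub_eq_add_neg]
  refine multipliable_one_add_of_summable <| Summable.of_nonneg_of_le (fun _ => norm_nonneg _)
    (fun n => ?_) (summable_geometric_of_lt_one (norm_nonneg x) hx)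
  rw [norm_neg, norm_pow]
  exact pow_le_pow_of_le_one (norm_nonneg x) hx.le (by omega)

theorem hasSum_pow_pentagonal_sub (hx : ‖x‖ < 1) :
    HasSum (fun k : ℕ => (-1) ^ k * (x ^ pentagonal (-k) - x ^ pentagonal (k + 1)))
      (∏' n, (1 - x ^ (n + 1))) := by
  have hgeo := summable_geometric_of_lt_one (norm_nonneg x) hx
  have hb (k : ℕ) := norm_pow_mul_prod_one_sub_pow_le hx k
  rw [Pentagonal.tprod_one_sub_pow (tendsto_pow_atTop_nhds_zero_of_norm_lt_one hx)
    (fun k => .of_norm_bounded (hgeo.mul_right _) (hb k)) (multipliable_one_sub_pow_add hx)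
    (summable_pow_pentagonal_sub hx) ?_]
  · exact (summable_pow_pentagonal_sub hx).hasSum
  · refine squeeze_zero_norm (a := fun k : ℕ => ‖x‖ ^ k *
      ∑' n : ℕ, ‖x‖ ^ n * Real.exp (1 - ‖x‖)⁻¹) (fun k => ?_) ?_
    · rw [norm_mul, norm_mul, norm_pow, norm_neg, norm_one, one_pow, one_mul, norm_pow]
      gcongr ?_ * ?_
      · refine pow_le_pow_of_le_one (norm_nonneg x) hx.le ?_
        rw [Nat.le_div_iff_mul_le (by norm_num)]
        nlinarith [Nat.zero_le (k * k)]
      · exact tsum_of_norm_bounded (hgeo.mul_right _).hasSum (hb k)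
    · simpa using (tendsto_pow_atTop_nhds_zero_of_lt_one (norm_nonneg x) hx).mul_const _

end Pentagonal

section HalfPlane

variable {w : ℂ}

lemma ne_zero_of_im_pos (hw : 0 < w.im) : w ≠ 0 := by
  rintro rfl
  exact hw.ne' zero_im

lemma im_neg_one_div_pos (hw : 0 < w.im) : 0 < (-1 / w).im := by
  have := UpperHalfPlane.im_inv_neg_coe_pos ⟨w, hw⟩
  rwa [show -1 / w = (-w)⁻¹ by rw [inv_neg, neg_div, one_div]]

lemma im_natCast_mul_pos (c : ℕ) [NeZero c] (hw : 0 < w.im) : 0 < ((c : ℂ) * w).im := by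
  have : 0 < c := NeZero.pos c
  rw [← ofReal_natCast, im_ofReal_mul]
  positivity

lemma im_add_intCast_div_pos {c : ℕ} (n : ℤ) (hw : 0 < w.im) : 0 < (w + n / c).im := by
  rw [show (n / c : ℂ) = ((n / c : ℝ) : ℂ) by push_cast; rfl]
  simpa using hw

lemma exp_pi_mul_I_mul_intCast (n : ℤ) : cexp (Real.pi * I * n) = (-1) ^ n := by
  rw [mul_comm, exp_int_mul, exp_pi_mul_I]

end HalfPlane

section Theta

lemma hasSum_jacobiTheta₂_residues (c : ℕ) [NeZero c] (z : ℂ) {τ : ℂ} (hτ : 0 < τ.im) :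
    HasSum (fun p : ℤ × Fin c => cexp (2 * Real.pi * I * (p.2 : ℕ) * z +
        Real.pi * I * (p.2 : ℕ) ^ 2 * τ) *
        jacobiTheta₂_term p.1 (c * z + c * (p.2 : ℕ) * τ) (c ^ 2 * τ)) (jacobiTheta₂ z τ) := by
  have h := (Int.divModEquiv c).symm.hasSum_iff.mpr (hasSum_jacobiTheta₂_term z hτ)
  refine h.congr_fun fun p => ?_
  simp only [Function.comp_apply, jacobiTheta₂_term, Int.divModEquiv_symm_apply, ← exp_add]
  push_cast
  ring_nf

lemma jacobiTheta₂_eq_sum_residues (c : ℕ) [NeZero c] (z : ℂ) {τ : ℂ} (hτ : 0 < τ.im) :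
    jacobiTheta₂ z τ = ∑ j : Fin c, cexp (2 * Real.pi * I * (j : ℕ) * z +
        Real.pi * I * (j : ℕ) ^ 2 * τ) * jacobiTheta₂ (c * z + c * (j : ℕ) * τ) (c ^ 2 * τ) := by
  have h := (Equiv.prodComm _ _).hasSum_iff.mpr (hasSum_jacobiTheta₂_residues c z hτ)
  refine (h.prod_fiberwise fun j => ?_).unique (hasSum_fintype _)
  exact (hasSum_jacobiTheta₂_term _ (mod_cast im_natCast_mul_pos (c ^ 2) hτ)).mul_left _

lemma jacobiTheta₂_add_int (z t : ℂ) (n : ℤ) : jacobiTheta₂ (z + n) t = jacobiTheta₂ z t := by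
  have hp : Function.Periodic (jacobiTheta₂ · t) 1 := fun z => jacobiTheta₂_add_left z t
  simpa using hp.int_mul n z

lemma jacobiTheta₂_add_int_mul (z t : ℂ) (n : ℤ) :
    jacobiTheta₂ (z + n * t) t =
      cexp (-Real.pi * I * (n ^ 2 * t + 2 * n * z)) * jacobiTheta₂ z t := by
  have hterm (j : ℤ) : jacobiTheta₂_term j (z + n * t) t =
      cexp (-Real.pi * I * (n ^ 2 * t + 2 * n * z)) * jacobiTheta₂_term (j + n) z t := by
    rw [jacobiTheta₂_term, jacobiTheta₂_term, ← exp_add]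
    push_cast
    ring_nf
  rw [jacobiTheta₂, tsum_congr hterm, tsum_mul_left, jacobiTheta₂]
  congr 1
  exact (Equiv.addRight n).tsum_eq (jacobiTheta₂_term · z t)

lemma jacobiTheta₂_add_intCast_right (z t : ℂ) (n : ℤ) :
    jacobiTheta₂ z (t + n) = jacobiTheta₂ (z + n / 2) t := by
  refine tsum_congr fun j => ?_
  obtain ⟨i, hi⟩ : Even (j * (j - 1)) := Int.even_mul_pred_self j
  have hi' : (j : ℂ) * (j - 1) = i + i := by exact_mod_cast hi
  rw [jacobiTheta₂_term, jacobiTheta₂_term, show 2 * Real.pi * I * j * z +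
    Real.pi * I * j ^ 2 * (t + n) = 2 * Real.pi * I * j * (z + n / 2) + Real.pi * I * j ^ 2 * t
      + ((n * i : ℤ) : ℂ) * (2 * Real.pi * I) by
        push_cast
        linear_combination Real.pi * I * n * hi',
    exp_add _ (((n * i : ℤ) : ℂ) * (2 * Real.pi * I)), exp_int_mul_two_pi_mul_I, mul_one]

lemma jacobiTheta₂_add_two_mul_int (z t : ℂ) (n : ℤ) :
    jacobiTheta₂ z (t + 2 * n) = jacobiTheta₂ z t := by
  have h := jacobiTheta₂_add_intCast_right z t (2 * n)
  rwa [Int.cast_mul, Int.cast_ofNat, mul_div_cancel_left₀ _ two_ne_zero, jacobiTheta₂_add_int] at h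

end Theta

section SqrtNegI

/-- The holomorphic square root `√(-i w)` on the upper half-plane. -/
noncomputable def sqrtNegI (w : ℂ) : ℂ := (-I * w) ^ (1 / 2 : ℂ)

lemma sqrtNegI_sq (w : ℂ) : sqrtNegI w ^ 2 = -I * w := by
  rw [sqrtNegI, ← cpow_nat_mul]
  simp

lemma sqrtNegI_pow_four_mul (w : ℂ) (n : ℕ) :
    sqrtNegI w ^ (4 * n) = (-1) ^ n * w ^ (2 * n) := by
  rw [show 4 = 2 * 2 from rfl, mul_assoc, pow_mul, pow_mul, sqrtNegI_sq, mul_pow, neg_sq, I_sq,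
    mul_pow, pow_mul]

lemma sqrtNegI_ne_zero {w : ℂ} (hw : w ≠ 0) : sqrtNegI w ≠ 0 := by
  rw [← pow_ne_zero_iff two_ne_zero, sqrtNegI_sq]
  simpa using hw

lemma sqrtNegI_ofReal_mul {a : ℝ} (ha : 0 < a) {w : ℂ} (hw : w ≠ 0) :
    sqrtNegI (a * w) = (√a : ℝ) * sqrtNegI w := by
  have hI : -I * w ≠ 0 := by simp [hw]
  rw [sqrtNegI, sqrtNegI, show -I * (a * w) = a * (-I * w) by ring,
    cpow_def_of_ne_zero (by simp [ha.ne', hw]), cpow_def_of_ne_zero hI,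
    log_ofReal_mul ha hI, add_mul, exp_add, Real.sqrt_eq_rpow, Real.rpow_def_of_pos ha]
  push_cast
  rfl

lemma jacobiTheta₂_neg_one_div {z t : ℂ} (ht : t ≠ 0) :
    jacobiTheta₂ (z / t) (-1 / t) =
      sqrtNegI t * cexp (Real.pi * I * z ^ 2 / t) * jacobiTheta₂ z t := by
  have hexp : cexp (-Real.pi * I * z ^ 2 / t) = (cexp (Real.pi * I * z ^ 2 / t))⁻¹ := by
    rw [← exp_neg]
    ring_nf
  rw [jacobiTheta₂_functional_equation z t, ← sqrtNegI, hexp]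
  field_simp [sqrtNegI_ne_zero ht, exp_ne_zero]

end SqrtNegI

section Eta

variable {w : ℂ}

lemma eta_eq_exp_mul_tprod (w : ℂ) : eta w = cexp (Real.pi * I * w / 12) *
    ∏' n : ℕ, (1 - cexp (2 * Real.pi * I * w) ^ (n + 1)) := by
  simp only [eta, eta_q_eq_pow, Function.Periodic.qParam]
  push_cast
  congr 2
  ring

lemma jacobiTheta₂_term_eq_pow_pentagonal (k : ℤ) (w : ℂ) :
    jacobiTheta₂_term k ((1 + w) / 2) (3 * w) =
      (-1) ^ k * cexp (2 * Real.pi * I * w) ^ pentagonal (-k) := by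
  have hp : (2 : ℂ) * (pentagonal (-k) : ℕ) = k * (3 * k + 1) := by
    exact_mod_cast two_mul_natCast_pentagonal_neg k
  rw [jacobiTheta₂_term, ← exp_nat_mul, ← exp_pi_mul_I_mul_intCast, ← exp_add]
  congr 1
  linear_combination -(Real.pi * I * w) * hp

theorem eta_eq_jacobiTheta₂ (hw : 0 < w.im) :
    eta w = cexp (Real.pi * I * w / 12) * jacobiTheta₂ ((1 + w) / 2) (3 * w) := by
  have hw3 : 0 < (3 * w).im := by simpa using hw
  have hq : ‖cexp (2 * Real.pi * I * w)‖ < 1 := norm_exp_two_pi_I_lt_one ⟨w, hw⟩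
  rw [eta_eq_exp_mul_tprod]
  congr 1
  refine (hasSum_pow_pentagonal_sub hq).unique <|
    (hasSum_jacobiTheta₂_term ((1 + w) / 2) hw3).nat_add_neg_add_one.congr_fun fun k => ?_
  have hsign : (-1 : ℂ) ^ (-((k : ℤ) + 1)) = -(-1) ^ k := by
    rw [zpow_neg, ← inv_zpow, inv_neg_one, zpow_add_one₀ (by norm_num), zpow_natCast, mul_neg_one]
  rw [jacobiTheta₂_term_eq_pow_pentagonal, jacobiTheta₂_term_eq_pow_pentagonal, neg_neg, hsign,
    zpow_natCast]
  ring

/-- The theta series `∑_{N ≡ i mod 12} exp(πi N² w / 12)`. -/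
noncomputable def thetaSeries12 (i : ℤ) (w : ℂ) : ℂ :=
  cexp (Real.pi * I * i ^ 2 * w / 12) * jacobiTheta₂ (i * w) (12 * w)

lemma thetaSeries12_neg (i : ℤ) (w : ℂ) : thetaSeries12 (-i) w = thetaSeries12 i w := by
  simp [thetaSeries12]

lemma thetaSeries12_add (i : ℤ) (w : ℂ) : thetaSeries12 (i + 12) w = thetaSeries12 i w := by
  rw [thetaSeries12, thetaSeries12, show ((i + 12 : ℤ) : ℂ) * w = i * w + 12 * w by push_cast; ring,
    jacobiTheta₂_add_left', ← mul_assoc, ← exp_add]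
  push_cast
  ring_nf

theorem eta_eq_thetaSeries12 (hw : 0 < w.im) :
    eta w = thetaSeries12 1 w - thetaSeries12 5 w := by
  have hw3 : 0 < (3 * w).im := by simpa using hw
  have h57 : thetaSeries12 5 w = thetaSeries12 7 w := by
    rw [← thetaSeries12_neg, ← thetaSeries12_add]
    norm_num
  rw [eta_eq_jacobiTheta₂ hw, jacobiTheta₂_eq_sum_residues 2 _ hw3, Fin.sum_univ_two, mul_add, h57,
    sub_eq_add_neg, thetaSeries12, thetaSeries12]
  congr 1
  · rw [← mul_assoc, ← exp_add, ← jacobiTheta₂_add_left (((1 : ℤ) : ℂ) * w)]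
    simp only [Fin.val_zero]
    push_cast
    congr 2 <;> ring
  · rw [← mul_assoc, ← exp_add, ← neg_mul, ← exp_add_pi_mul_I,
      ← jacobiTheta₂_add_left (((7 : ℤ) : ℂ) * w)]
    simp only [Fin.val_one]
    push_cast
    congr 2 <;> ring_nf

theorem eta_neg_one_div (hw : 0 < w.im) : eta (-1 / w) = sqrtNegI w * eta w := by
  have hw0 := ne_zero_of_im_pos hw
  have h : eta (-1 / w) = (Complex.sqrt I)⁻¹ * (Complex.sqrt w * eta w) :=
    eta_comp_eq_csqrt_I_inv hw
  have harg : (-I).arg + w.arg ∈ Set.Ioc (-Real.pi) Real.pi := by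
    rw [arg_neg_I]
    have := arg_nonneg_iff.mpr hw.le
    have := arg_le_pi w
    constructor <;> linarith [Real.pi_pos]
  rw [h, ← mul_assoc]
  congr 1
  rw [sqrtNegI, Complex.sqrt, Complex.sqrt, cpow_def_of_ne_zero I_ne_zero,
    cpow_def_of_ne_zero hw0, cpow_def_of_ne_zero (by simp [hw0]),
    log_mul (by simp) hw0 harg, ← exp_neg, ← exp_add, log_I, log_neg_I]
  ring_nf

lemma jacobiTheta₂_twelfth_neg_one_div (j : ℤ) (hw : 0 < w.im) :
    jacobiTheta₂ (j / 12) (-1 / w / 12) = √12 * sqrtNegI w * thetaSeries12 j w := by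
  have hw0 := ne_zero_of_im_pos hw
  have h := jacobiTheta₂_neg_one_div (z := j * w) (t := 12 * w) (by simp [hw0])
  have h12 := sqrtNegI_ofReal_mul (a := 12) (by norm_num) hw0
  push_cast at h12
  rw [show (j : ℂ) / 12 = j * w / (12 * w) by field_simp, show -1 / w / 12 = -1 / (12 * w) by
    field_simp, h, h12, thetaSeries12, show Real.pi * I * (j * w) ^ 2 / (12 * w) =
      Real.pi * I * j ^ 2 * w / 12 by field_simp]
  ring

theorem sqrt_twelve_mul_eta (hw : 0 < w.im) :
    √12 * eta w = jacobiTheta₂ (1 / 12) (w / 12) - jacobiTheta₂ (5 / 12) (w / 12) := by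
  have hw0 := ne_zero_of_im_pos hw
  have hv := im_neg_one_div_pos hw
  have h1 := jacobiTheta₂_twelfth_neg_one_div 1 hv
  have h5 := jacobiTheta₂_twelfth_neg_one_div 5 hv
  have h := eta_neg_one_div hv
  rw [show -1 / (-1 / w) = w by field_simp] at h h1 h5
  push_cast at h1 h5
  rw [h, h1, h5, eta_eq_thetaSeries12 hv]
  ring

end Eta

section ThetaTransforms

variable {a b c d : ℤ} {t : ℂ}

lemma intCast_mul_add_intCast_ne_zero (h : IsCoprime c d) (ht : 0 < t.im) :
    (c : ℂ) * t + d ≠ 0 := by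
  have hcd : (![(c : ℝ), d] : Fin 2 → ℝ) ≠ 0 := by
    intro h0
    have hc : c = 0 := by simpa using congrFun h0 0
    have hd : d = 0 := by simpa using congrFun h0 1
    exact not_isCoprime_zero_zero (R := ℤ) (by rwa [hc, hd] at h)
  simpa using UpperHalfPlane.linear_ne_zero ⟨t, ht⟩ hcd

lemma im_moebius_pos (hdet : a * d - b * c = 1) (ht : 0 < t.im) :
    0 < ((a * t + b) / (c * t + d)).im := by
  let γ : SL(2, ℤ) := ⟨!![a, b; c, d], by rwa [Matrix.det_fin_two_of]⟩
  have h := (γ • (⟨t, ht⟩ : ℍ)).im_pos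
  rw [← coe_im, coe_specialLinearGroup_apply] at h
  simpa [γ] using h

lemma neg_one_zpow_congr {m n : ℤ} (h : Even (m - n)) : ((-1 : ℂ)) ^ m = (-1) ^ n := by
  rw [← sub_add_cancel m n, zpow_add₀ (by norm_num), h.neg_one_zpow, one_mul]

/-- The transformation law of `Θ(z, t) = jacobiTheta₂ z t` under the matrix `(a b; c d)`, with the
factor `κ` known up to a fourth root of unity: `κ` absorbs both the square root of `ct + d` and the
exponential that comes from the half-period `(act + bd)/2`. -/
def ThetaTransforms (a b c d : ℤ) : Prop :=
  ∀ t : ℂ, 0 < t.im → ∃ κ : ℂ,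
    κ ^ 4 = (-1) ^ (b * c) * (c * t + d) ^ 2 * cexp (Real.pi * I * (a * c) ^ 2 * t) ∧
    ∀ z : ℂ, jacobiTheta₂ (z / (c * t + d)) ((a * t + b) / (c * t + d)) =
      κ * cexp (Real.pi * I * (c * z ^ 2 / (c * t + d) + a * c * z)) *
        jacobiTheta₂ (z + (a * c * t + b * d) / 2) t

lemma ThetaTransforms.mul_T_zpow (h : ThetaTransforms a b c d) (hdet : a * d - b * c = 1) (n : ℤ) :
    ThetaTransforms a (b + n * a) c (d + n * c) := by
  intro t ht
  obtain ⟨κ, hκ, hz⟩ := h (t + n) (by simpa using ht)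
  have hden : (c : ℂ) * t + ((d + n * c : ℤ) : ℂ) = c * (t + n) + d := by push_cast; ring
  have hnum : (a : ℂ) * t + ((b + n * a : ℤ) : ℂ) = a * (t + n) + b := by push_cast; ring
  refine ⟨κ, ?_, fun z => ?_⟩
  · have hparity : Even ((b * c + (a * c) ^ 2 * n) - (b + n * a) * c) := by
      rw [show (b * c + (a * c) ^ 2 * n) - (b + n * a) * c = n * (a * c * (a * c - 1)) by ring]
      exact (Int.even_mul_pred_self _).mul_left n
    rw [hκ, hden, ← neg_one_zpow_congr hparity, zpow_add₀ (by norm_num),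
      ← exp_pi_mul_I_mul_intCast ((a * c) ^ 2 * n), show Real.pi * I * (a * c) ^ 2 * (t + n) =
        Real.pi * I * ((a * c) ^ 2 * n : ℤ) + Real.pi * I * (a * c) ^ 2 * t by push_cast; ring,
      exp_add]
    ring
  · obtain ⟨j, hj⟩ : Even (n * (n - 1)) := Int.even_mul_pred_self n
    have hj' : (n : ℂ) * (n - 1) = j + j := by exact_mod_cast hj
    have hdet' : (a : ℂ) * d - b * c = 1 := by exact_mod_cast hdet
    rw [hden, hnum, hz z, jacobiTheta₂_add_intCast_right,
      ← jacobiTheta₂_add_int _ _ (n * (b * c) + j * (a * c))]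
    congr 2
    push_cast
    linear_combination (-n / 2 : ℂ) * hdet' - (a * c / 2 : ℂ) * hj'

lemma exp_inversion_root (a b c d : ℤ) (ht0 : t ≠ 0) :
    cexp (Real.pi * I * (b * d * t - a * c) ^ 2 / 4 / t) ^ 4 *
        cexp (Real.pi * I * (a * c) ^ 2 * (-1 / t)) = cexp (Real.pi * I * (b * d) ^ 2 * t) := by
  rw [← exp_nat_mul, ← exp_add, show (4 : ℕ) * (Real.pi * I * (b * d * t - a * c) ^ 2 / 4 / t) +
    Real.pi * I * (a * c) ^ 2 * (-1 / t) = Real.pi * I * (b * d) ^ 2 * t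
      + ((-(a * b * c * d) : ℤ) : ℂ) * (2 * Real.pi * I) by push_cast; field_simp; ring,
    exp_add, exp_int_mul_two_pi_mul_I, mul_one]

lemma exp_inversion_cocycle (a b z : ℂ) {c d : ℂ} (ht0 : t ≠ 0) (hden : d * t - c ≠ 0) :
    cexp (Real.pi * I * (c * (z / t) ^ 2 / ((d * t - c) / t) + a * c * (z / t))) *
        cexp (Real.pi * I * (z + (b * d * t - a * c) / 2) ^ 2 / t) =
      cexp (Real.pi * I * (b * d * t - a * c) ^ 2 / 4 / t) *
        cexp (Real.pi * I * (d * z ^ 2 / (d * t - c) + b * d * z)) := by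
  rw [← exp_add, ← exp_add]
  congr 1
  obtain ⟨J, rfl⟩ : ∃ J, c = d * t - J := ⟨d * t - c, by ring⟩
  rw [sub_sub_cancel] at hden ⊢
  field_simp
  ring

lemma ThetaTransforms.mul_S (h : ThetaTransforms a b c d) (hdet : a * d - b * c = 1) :
    ThetaTransforms b (-a) d (-c) := by
  intro t ht
  have ht0 := ne_zero_of_im_pos ht
  have hden : (d : ℂ) * t - c ≠ 0 := by
    simpa [sub_eq_add_neg] using
      intCast_mul_add_intCast_ne_zero (c := d) (d := -c) ⟨a, b, by linarith⟩ ht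
  obtain ⟨κ, hκ, hz⟩ := h (-1 / t) (im_neg_one_div_pos ht)
  have hc : (c : ℂ) * (-1 / t) + d = (d * t - c) / t := by field_simp; ring
  refine ⟨κ * sqrtNegI t * cexp (Real.pi * I * (b * d * t - a * c) ^ 2 / 4 / t), ?_, fun z => ?_⟩
  · have hsign : (-1 : ℂ) ^ (-a * d) = -1 * (-1) ^ (b * c) := by
      rw [← zpow_one_add₀ (by norm_num)]
      exact neg_one_zpow_congr ⟨-(1 + b * c), by linarith⟩
    rw [mul_pow, mul_pow, hκ, sqrtNegI_pow_four_mul t 1, hsign, ← exp_inversion_root a b c d ht0,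
      hc]
    push_cast
    field_simp
    ring
  · have ha : ((a : ℂ) * (-1 / t) + b) / ((d * t - c) / t) = (b * t - a) / (d * t - c) := by
      field_simp
      ring
    have hshift : z / t + (a * c * (-1 / t) + b * d) / 2 = (z + (b * d * t - a * c) / 2) / t := by
      field_simp
      ring
    have hhalf : z + (b * d * t + ((-a : ℤ) : ℂ) * ((-c : ℤ) : ℂ)) / 2 =
        z + (b * d * t - a * c) / 2 + ((a * c : ℤ) : ℂ) := by push_cast; ring
    have hz := hz (z / t)
    rw [hc, div_div_div_cancel_right₀ ht0, ha, hshift, jacobiTheta₂_neg_one_div ht0] at hz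
    rw [hhalf, jacobiTheta₂_add_int]
    simp only [Int.cast_neg, ← sub_eq_add_neg]
    rw [hz]
    linear_combination κ * sqrtNegI t * jacobiTheta₂ (z + (b * d * t - a * c) / 2) t *
      exp_inversion_cocycle a b z ht0 hden

lemma ThetaTransforms.neg (h : ThetaTransforms a b c d) :
    ThetaTransforms (-a) (-b) (-c) (-d) := by
  intro t ht
  obtain ⟨κ, hκ, hz⟩ := h t ht
  have hden : ((-c : ℤ) : ℂ) * t + ((-d : ℤ) : ℂ) = -(c * t + d) := by push_cast; ring
  have hnum : ((-a : ℤ) : ℂ) * t + ((-b : ℤ) : ℂ) = -(a * t + b) := by push_cast; ring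
  refine ⟨κ, ?_, fun z => ?_⟩
  · rw [hκ, hden, neg_mul_neg]
    push_cast
    ring_nf
  · rw [hden, hnum, neg_div_neg_eq, div_neg, jacobiTheta₂_neg_left, hz z]
    push_cast
    simp only [div_neg, neg_mul, mul_neg, neg_neg, neg_div]

lemma det_fin_two_eq_one (γ : SL(2, ℤ)) : γ 0 0 * γ 1 1 - γ 0 1 * γ 1 0 = 1 := by
  rw [← Matrix.det_fin_two, γ.det_coe]

lemma thetaTransforms_SL (γ : SL(2, ℤ)) :
    ThetaTransforms (γ 0 0) (γ 0 1) (γ 1 0) (γ 1 1) := by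
  have hγ : γ ∈ Subgroup.closure {ModularGroup.S, ModularGroup.T} := by
    rw [SpecialLinearGroup.SL2Z_generators]
    trivial
  have hS (x : SL(2, ℤ)) (h : ThetaTransforms (x 0 0) (x 0 1) (x 1 0) (x 1 1)) :
      ThetaTransforms ((x * ModularGroup.S) 0 0) ((x * ModularGroup.S) 0 1)
        ((x * ModularGroup.S) 1 0) ((x * ModularGroup.S) 1 1) := by
    simpa [ModularGroup.coe_S, Matrix.mul_apply, Fin.sum_univ_two]
      using h.mul_S (det_fin_two_eq_one x)
  induction hγ using Subgroup.closure_induction_right with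
  | one => exact fun t _ => ⟨1, by simp, fun z => by simp⟩
  | mul_right x _ y hy ih =>
    rcases hy with rfl | rfl
    · exact hS x ih
    · simpa [ModularGroup.coe_T, Matrix.mul_apply, Fin.sum_univ_two, add_comm]
        using ih.mul_T_zpow (det_fin_two_eq_one x) 1
  | mul_inv_cancel x _ y hy ih =>
    rcases hy with rfl | rfl
    · rw [ModularGroup.S_inv, mul_neg]
      simpa using (hS x ih).neg
    · simpa [ModularGroup.coe_T_inv, Matrix.mul_apply, Fin.sum_univ_two, add_comm]
        using ih.mul_T_zpow (det_fin_two_eq_one x) (-1)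

theorem thetaTransforms (hdet : a * d - b * c = 1) : ThetaTransforms a b c d := by
  simpa using thetaTransforms_SL ⟨!![a, b; c, d], by rwa [Matrix.det_fin_two_of]⟩

end ThetaTransforms

/-! ### Level `576` -/

section Chi12

lemma chi12Int_eq_zero_or (a : ZMod 12) : chi12Int a = 0 ∨ chi12Int a = 1 ∨ chi12Int a = -1 := by
  decide +revert

lemma chi12Int_pow_of_odd (a : ZMod 12) {r : ℕ} (hr : Odd r) : chi12Int a ^ r = chi12Int a := by
  rcases chi12Int_eq_zero_or a with h | h | h
  · rw [h, zero_pow hr.pos.ne']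
  · rw [h, one_pow]
  · rw [h, hr.neg_one_pow]

lemma isUnit_intCast_zmod_576_iff {n : ℤ} :
    IsUnit (n : ZMod 576) ↔ IsUnit (n : ZMod 12) := by
  rw [ZMod.coe_int_isUnit_iff_isCoprime, ZMod.coe_int_isUnit_iff_isCoprime]
  refine ⟨fun h => h.of_isCoprime_of_dvd_left (by norm_num), fun h => ?_⟩
  exact (h.pow_left (m := 3)).of_isCoprime_of_dvd_left (by norm_num)

lemma chi12_intCast (n : ℤ) : chi12 (n : ZMod 576) = chi12Int (n : ZMod 12) := by
  by_cases hn : IsUnit (n : ZMod 576)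
  · have h := DirichletCharacter.changeLevel_eq_cast_of_dvd
      (chi12Int.ringHomComp (Int.castRingHom ℂ)) (show 12 ∣ 576 by norm_num) hn.unit
    rw [hn.unit_spec] at h
    rw [chi12, h]
    simp
  · rw [MulChar.map_nonunit _ hn,
      MulChar.map_nonunit _ (mt isUnit_intCast_zmod_576_iff.mpr hn), Int.cast_zero]

lemma sub_five_mul_eq_chi12Int_mul_zmod {R : Type*} [Ring R] {g : ZMod 12 → R}
    (heven : Function.Even g) (a : ZMod 12) : g a - g (5 * a) = chi12Int a * (g 1 - g 5) := by
  have hcases : (chi12Int a = 1 ∧ (a = 1 ∨ a = -1)) ∨ (chi12Int a = -1 ∧ (a = 5 ∨ a = -5)) ∨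
      (chi12Int a = 0 ∧ (5 * a = a ∨ 5 * a = -a)) := by
    decide +revert
  have h25 : (5 * 5 : ZMod 12) = 1 := by decide
  rcases hcases with ⟨h, rfl | rfl⟩ | ⟨h, rfl | rfl⟩ | ⟨h, h5 | h5⟩ <;>
    simp [heven _, *]

lemma sub_five_mul_eq_chi12Int_mul {R : Type*} [Ring R] {f : ℤ → R}
    (hper : Function.Periodic f 12) (heven : Function.Even f) (n : ℤ) :
    f n - f (5 * n) = chi12Int (n : ZMod 12) * (f 1 - f 5) := by
  have hval (i : ℤ) : f ((i : ZMod 12).val) = f i := by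
    rw [ZMod.val_intCast]
    have := hper.int_mul (i / 12) (i % 12)
    rwa [Int.cast_id, Int.emod_add_ediv_mul, eq_comm] at this
  have hg : Function.Even fun a : ZMod 12 => f a.val := fun a => by
    obtain ⟨i, rfl⟩ := ZMod.intCast_surjective a
    simp only
    rw [← Int.cast_neg, hval, hval, heven]
  have h := sub_five_mul_eq_chi12Int_mul_zmod hg n
  simpa only [hval, ← Int.cast_ofNat (R := ZMod 12), ← Int.cast_mul, ← Int.cast_one (R := ZMod 12)]
    using h

end Chi12

section GammaZero

variable {a b c d : ℤ} {t : ℂ}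

lemma jacobiTheta₂_twelfth_transform (hdet : a * d - 2 * b * (288 * c) = 1) (ht : 0 < t.im) :
    ∃ κ : ℂ, κ ^ 4 = (288 * c * t + d) ^ 2 ∧ ∀ j : ℤ,
      jacobiTheta₂ (j / 12) ((a * t + 2 * b) / (288 * c * t + d)) =
        κ * jacobiTheta₂ (((d * j : ℤ) : ℂ) / 12) t := by
  obtain ⟨κ, hκ, hz⟩ := thetaTransforms hdet t ht
  have hden := intCast_mul_add_intCast_ne_zero (c := 288 * c) (d := d)
    ⟨-2 * b, a, by linarith⟩ ht
  push_cast at hκ hz hden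
  refine ⟨κ * cexp (-Real.pi * I * (144 * a * c) ^ 2 * t), ?_, fun j => ?_⟩
  · have hsign : (-1 : ℂ) ^ (2 * b * (288 * c)) = 1 := by
      rw [mul_assoc]
      exact (even_two_mul _).neg_one_zpow
    rw [mul_pow, hκ, hsign, ← exp_nat_mul, mul_assoc, ← exp_add]
    ring_nf
    simp
  · have hz := hz ((288 * c * t + d) * (j / 12))
    rw [mul_div_cancel_left₀ _ hden] at hz
    have hshift : (288 * c * t + d) * ((j : ℂ) / 12) + (a * (288 * c) * t + 2 * b * d) / 2 =
        ((d * j : ℤ) : ℂ) / 12 + ((24 * c * j + 144 * a * c : ℤ) : ℂ) * t + ((b * d : ℤ) : ℂ) := by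
      push_cast
      ring
    have hsq : 288 * c * ((288 * c * t + d) * ((j : ℂ) / 12)) ^ 2 / (288 * c * t + d) =
        288 * c * (288 * c * t + d) * (j / 12) ^ 2 := by
      field_simp
    rw [hz, hshift, jacobiTheta₂_add_int, jacobiTheta₂_add_int_mul, ← mul_assoc, mul_assoc κ,
      ← exp_add, hsq]
    congr 2
    rw [show Real.pi * I * (288 * c * (288 * c * t + d) * ((j : ℂ) / 12) ^ 2 +
        a * (288 * c) * ((288 * c * t + d) * (j / 12))) +
        -Real.pi * I * (((24 * c * j + 144 * a * c : ℤ) : ℂ) ^ 2 * t +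
          2 * ((24 * c * j + 144 * a * c : ℤ) : ℂ) * (((d * j : ℤ) : ℂ) / 12)) =
        -Real.pi * I * (144 * a * c) ^ 2 * t + ((-(c * d * j ^ 2) : ℤ) : ℂ) * (2 * Real.pi * I) by
          push_cast; ring, exp_add, exp_int_mul_two_pi_mul_I, mul_one]

lemma exists_factor_jacobiTheta₂_eta (hdet : a * d - 2 * b * (288 * c) = 1) (ht : 0 < t.im) :
    ∃ κ : ℂ, κ ^ 4 = (288 * c * t + d) ^ 2 ∧
      jacobiTheta₂ 0 ((a * t + 2 * b) / (288 * c * t + d)) = κ * jacobiTheta₂ 0 t ∧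
      eta (12 * ((a * t + 2 * b) / (288 * c * t + d))) =
        chi12Int (d : ZMod 12) * κ * eta (12 * t) := by
  obtain ⟨κ, hκ, htorsion⟩ := jacobiTheta₂_twelfth_transform hdet ht
  have ht' := im_moebius_pos hdet ht
  push_cast at ht'
  refine ⟨κ, hκ, by simpa using htorsion 0, mul_left_cancel₀ (a := (√12 : ℂ)) (by simp) ?_⟩
  generalize (a * t + 2 * b) / (288 * c * t + d) = t' at *
  have heta {z : ℂ} (hz : 0 < z.im) :
      √12 * eta (12 * z) = jacobiTheta₂ (1 / 12) z - jacobiTheta₂ (5 / 12) z := by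
    simpa using sqrt_twelve_mul_eta (w := 12 * z) (by simpa using hz)
  have hχ := sub_five_mul_eq_chi12Int_mul (f := fun j : ℤ => jacobiTheta₂ (j / 12) t)
    (fun j => by
      simp only [Int.cast_add, Int.cast_ofNat, add_div, div_self (OfNat.ofNat_ne_zero (R := ℂ) 12),
        jacobiTheta₂_add_left])
    (fun j => by simp only [Int.cast_neg, neg_div, jacobiTheta₂_neg_left]) d
  have h1 := htorsion 1
  have h5 := htorsion 5
  rw [mul_comm d 5] at h5
  push_cast [mul_one] at h1 h5 hχ
  linear_combination heta ht' + h1 - h5 + κ * hχ - chi12Int (d : ZMod 12) * κ * heta ht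

lemma coe_mul24 (τ : ℍ) : (mul24 τ : ℂ) = 24 * τ := rfl

theorem exists_factor_theta_eta {γ : SL(2, ℤ)} (hγ : γ ∈ CongruenceSubgroup.Gamma0 576) (τ : ℍ) :
    ∃ κ : ℂ, κ ^ 4 = ((γ 1 0 : ℤ) * (τ : ℂ) + (γ 1 1 : ℤ)) ^ 2 ∧
      theta (γ • τ) = κ * theta τ ∧
      eta (mul24 (γ • τ)) = chi12 ((γ 1 1 : ℤ) : ZMod 576) * κ * eta (mul24 τ) := by
  rw [CongruenceSubgroup.Gamma0_mem, ZMod.intCast_zmod_eq_zero_iff_dvd] at hγ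
  obtain ⟨c, hc⟩ := hγ
  have hdet : γ 0 0 * γ 1 1 - 2 * γ 0 1 * (288 * c) = 1 := by
    have h := det_fin_two_eq_one γ
    rw [hc] at h
    push_cast at h
    linarith
  obtain ⟨κ, hκ, hθ, hη⟩ := exists_factor_jacobiTheta₂_eta (t := 2 * τ) hdet
    (by simpa using τ.im_pos)
  have hden : 288 * (c : ℂ) * (2 * τ) + (γ 1 1 : ℤ) = (γ 1 0 : ℤ) * τ + (γ 1 1 : ℤ) := by
    rw [hc]
    push_cast
    ring
  have hsmul : ((γ 0 0 : ℤ) * (2 * (τ : ℂ)) + 2 * (γ 0 1 : ℤ)) /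
      ((γ 1 0 : ℤ) * τ + (γ 1 1 : ℤ)) = 2 * (γ • τ : ℍ) := by
    rw [coe_specialLinearGroup_apply]
    simp only [algebraMap_int_eq, eq_intCast, ofReal_intCast]
    ring
  rw [hden] at hκ hθ hη
  rw [hsmul] at hθ hη
  refine ⟨κ, hκ, by simpa [theta, jacobiTheta_eq_jacobiTheta₂] using hθ, ?_⟩
  rw [chi12_intCast, coe_mul24, coe_mul24, show (24 : ℂ) = 12 * 2 by norm_num, mul_assoc, hη,
    mul_assoc 12]

end GammaZero

/-! ### Quadratic Gauss sums -/

section QuadraticGaussSum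

/-- The quadratic Gauss sum `∑_{j mod c} exp(2πi A j² / c)`. -/
noncomputable def quadGaussSum (c : ℕ) [NeZero c] (A : ZMod c) : ℂ :=
  ∑ j : ZMod c, ZMod.stdAddChar (A * j ^ 2)

lemma sum_addChar_complete_square {R S : Type*} [CommRing R] [Fintype R] [CommRing S]
    (ψ : AddChar R S) {a b : R} (h : 4 * a * b = 1) (n : R) :
    ∑ j, ψ (a * j ^ 2 - n * j) = ψ (-b * n ^ 2) * ∑ j, ψ (a * j ^ 2) := by
  rw [Finset.mul_sum]
  refine Fintype.sum_equiv (Equiv.subRight (2 * b * n)) _ _ fun j => ?_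
  rw [← AddChar.map_add_eq_mul, Equiv.subRight_apply]
  congr 1
  linear_combination (j * n - b * n ^ 2) * h

variable {c : ℕ} [NeZero c]

lemma sum_fin_eq_sum_zmod {M : Type*} [AddCommMonoid M] (f : ZMod c → M) :
    ∑ j : Fin c, f ((j : ℕ) : ZMod c) = ∑ j : ZMod c, f j := by
  refine Fintype.sum_equiv (ZMod.finEquiv c).toEquiv _ _ fun j => ?_
  cases c with
  | zero => exact (NeZero.ne 0 rfl).elim
  | succ n => exact congrArg f (Fin.cast_val_eq_self j)

variable {A B : ℤ} {t : ℂ}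

lemma sum_fin_exp_quadratic (h : (4 * A * B : ZMod c) = 1) (n : ℤ) :
    ∑ j : Fin c, cexp (2 * Real.pi * I * (A * (j : ℕ) ^ 2 - n * (j : ℕ)) / c) =
      cexp (2 * Real.pi * I * (-B * n ^ 2) / c) * quadGaussSum c A := by
  have hexp (i : ℤ) : cexp (2 * Real.pi * I * i / c) = ZMod.stdAddChar (i : ZMod c) :=
    (ZMod.stdAddChar_coe i).symm
  have hsum := sum_addChar_complete_square ZMod.stdAddChar h (n : ZMod c)
  have hlhs := hexp (-B * n ^ 2)
  have hrhs (j : Fin c) := hexp (A * (j : ℕ) ^ 2 - n * (j : ℕ))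
  push_cast at hlhs hrhs
  rw [hlhs, Finset.sum_congr rfl fun j _ => hrhs j, quadGaussSum, ← hsum, ← sum_fin_eq_sum_zmod]

lemma sum_exp_mul_jacobiTheta₂ (h : (4 * A * B : ZMod c) = 1) (z : ℂ) (ht : 0 < t.im) :
    ∑ j : Fin c, cexp (2 * Real.pi * I * (A * (j : ℕ) ^ 2) / c) *
        jacobiTheta₂ (z - (j : ℕ) / c) (t + 2 * B / c) =
      quadGaussSum c A * jacobiTheta₂ z t := by
  have hc0 : (c : ℂ) ≠ 0 := NeZero.ne _
  have ht' : 0 < (t + 2 * B / c).im := by exact_mod_cast im_add_intCast_div_pos (2 * B) ht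
  have hterm (n : ℤ) (j : Fin c) : cexp (2 * Real.pi * I * (A * (j : ℕ) ^ 2) / c) *
      jacobiTheta₂_term n (z - (j : ℕ) / c) (t + 2 * B / c) =
      cexp (2 * Real.pi * I * (A * (j : ℕ) ^ 2 - n * (j : ℕ)) / c) *
      (cexp (2 * Real.pi * I * (B * n ^ 2) / c) * jacobiTheta₂_term n z t) := by
    simp only [jacobiTheta₂_term, ← exp_add]
    congr 1
    field_simp
    ring
  refine (hasSum_sum fun (j : Fin c) _ => (hasSum_jacobiTheta₂_term _ ht').mul_left _).unique ?_
  refine ((hasSum_jacobiTheta₂_term z ht).mul_left (quadGaussSum c A)).congr_fun fun n => ?_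
  have hcancel : cexp (2 * Real.pi * I * (-B * n ^ 2) / c) *
      cexp (2 * Real.pi * I * (B * n ^ 2) / c) = 1 := by
    rw [← exp_add, ← add_div, ← mul_add, neg_mul, neg_add_cancel, mul_zero, zero_div, exp_zero]
  rw [Finset.sum_congr rfl fun j _ => hterm n j, ← Finset.sum_mul, sum_fin_exp_quadratic h]
  linear_combination quadGaussSum c A * jacobiTheta₂_term n z t * hcancel

lemma jacobiTheta₂_rational_sub_one_div (A : ℤ) (x : ℂ) (ht : 0 < t.im) :
    jacobiTheta₂ x (2 * A / c + -1 / (c ^ 2 * t)) =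
      sqrtNegI t * cexp (Real.pi * I * c ^ 2 * x ^ 2 * t) *
        ∑ j : Fin c, cexp (2 * Real.pi * I * (A * (j : ℕ) ^ 2) / c) *
          jacobiTheta₂ (c * x * t - (j : ℕ) / c) t := by
  have hc0 : (c : ℂ) ≠ 0 := NeZero.ne _
  have ht0 := ne_zero_of_im_pos ht
  have him : 0 < (2 * A / c + -1 / ((c : ℂ) ^ 2 * t)).im := by
    rw [add_comm]
    exact_mod_cast
      im_add_intCast_div_pos (2 * A) (im_neg_one_div_pos (im_natCast_mul_pos (c ^ 2) ht))
  rw [jacobiTheta₂_eq_sum_residues c _ him, Finset.mul_sum]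
  refine Finset.sum_congr rfl fun j _ => ?_
  have hz : (c : ℂ) * x + c * (j : ℕ) * (2 * A / c + -1 / (c ^ 2 * t)) =
      (c * x * t - (j : ℕ) / c) / t + ((2 * A * (j : ℕ) : ℤ) : ℂ) := by
    push_cast
    field_simp
    ring
  have hτ : (c : ℂ) ^ 2 * (2 * A / c + -1 / (c ^ 2 * t)) = -1 / t + 2 * ((A * c : ℤ) : ℂ) := by
    push_cast
    field_simp
    ring
  have hexp : cexp (2 * Real.pi * I * (j : ℕ) * x +
        Real.pi * I * (j : ℕ) ^ 2 * (2 * A / c + -1 / (c ^ 2 * t))) *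
      cexp (Real.pi * I * (c * x * t - (j : ℕ) / c) ^ 2 / t) =
      cexp (Real.pi * I * c ^ 2 * x ^ 2 * t) *
        cexp (2 * Real.pi * I * (A * (j : ℕ) ^ 2) / c) := by
    rw [← exp_add, ← exp_add]
    congr 1
    field_simp
    ring
  rw [hz, hτ, jacobiTheta₂_add_int, jacobiTheta₂_add_two_mul_int, jacobiTheta₂_neg_one_div ht0]
  linear_combination sqrtNegI t * jacobiTheta₂ (c * x * t - (j : ℕ) / c) t * hexp

theorem jacobiTheta₂_eq_quadGaussSum_mul (h : (4 * A * B : ZMod c) = 1) (x : ℂ) (ht : 0 < t.im) :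
    jacobiTheta₂ x (2 * A / c + -1 / (c ^ 2 * (t + 2 * B / c))) =
      sqrtNegI (t + 2 * B / c) * cexp (Real.pi * I * c ^ 2 * x ^ 2 * (t + 2 * B / c)) *
        (quadGaussSum c A * jacobiTheta₂ (c * x * (t + 2 * B / c)) t) := by
  have ht' : 0 < (t + 2 * B / c).im := by exact_mod_cast im_add_intCast_div_pos (2 * B) ht
  rw [jacobiTheta₂_rational_sub_one_div A x ht', sum_exp_mul_jacobiTheta₂ h _ ht]

variable {D : ℤ} {w : ℂ}

lemma jacobiTheta₂_twelfth_eq_quadGaussSum_mul (hdet : 24 * A * (24 * D) - B * c = 1)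
    (hw : 0 < w.im) (i : ℤ) :
    jacobiTheta₂ (i / 12) ((24 * A * w + B) / (c * w + 24 * D) / 12) =
      sqrtNegI (12 / c * (c * w + 24 * D)) * quadGaussSum c A * thetaSeries12 (i * c) w := by
  have hc0 : (c : ℂ) ≠ 0 := NeZero.ne _
  have hden := intCast_mul_add_intCast_ne_zero (c := c) (d := 24 * D) ⟨-B, 24 * A, by linarith⟩ hw
  have hdetC : (24 * A * (24 * D) - B * c : ℂ) = 1 := by exact_mod_cast hdet
  have hmod : (4 * A * (144 * D : ℤ) : ZMod c) = 1 := by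
    have := congrArg (Int.cast : ℤ → ZMod c) hdet
    push_cast at this ⊢
    rw [ZMod.natCast_self] at this
    linear_combination this
  have h := jacobiTheta₂_eq_quadGaussSum_mul hmod (i / 12) (t := 12 * w) (by simpa using hw)
  have ht : 12 * w + 2 * (144 * D : ℤ) / c = 12 / c * (c * w + 24 * D) := by
    push_cast
    field_simp
    ring
  have hτ : 2 * A / c + -1 / (c ^ 2 * (12 / c * (c * w + 24 * D))) =
      (24 * A * w + B) / (c * w + 24 * D) / 12 := by
    push_cast at hden
    field_simp
    linear_combination hdetC
  have hz : c * ((i : ℂ) / 12) * (12 / c * (c * w + 24 * D)) =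
      ((i * c : ℤ) : ℂ) * w + ((24 * D * i : ℤ) : ℂ) := by
    push_cast
    field_simp
  have hexp : Real.pi * I * c ^ 2 * (i / 12) ^ 2 * (12 / c * (c * w + 24 * D)) =
      Real.pi * I * ((i * c : ℤ) : ℂ) ^ 2 * w / 12 +
        ((c * D * i ^ 2 : ℤ) : ℂ) * (2 * Real.pi * I) := by
    push_cast
    field_simp
    ring
  rw [ht, hτ, hz, hexp, jacobiTheta₂_add_int, exp_add, exp_int_mul_two_pi_mul_I, mul_one] at h
  rw [h, thetaSeries12]
  ring

theorem eta_moebius_eq_quadGaussSum_mul (hdet : 24 * A * (24 * D) - B * c = 1) (hw : 0 < w.im) :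
    eta ((24 * A * w + B) / (c * w + 24 * D)) =
      chi12Int c * (quadGaussSum c A / √c) * sqrtNegI (c * w + 24 * D) * eta w := by
  have hden := intCast_mul_add_intCast_ne_zero (c := c) (d := 24 * D) ⟨-B, 24 * A, by linarith⟩ hw
  have him := im_moebius_pos hdet hw
  have hc : (0 : ℝ) < c := by exact_mod_cast NeZero.pos c
  have hsqrt (x : ℂ) (hx : x ≠ 0) :
      sqrtNegI (12 / c * x) = (√12 : ℝ) / (√c : ℝ) * sqrtNegI x := by
    have := sqrtNegI_ofReal_mul (a := 12 / c) (by positivity) hx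
    rw [Real.sqrt_div (by norm_num)] at this
    push_cast at this
    exact this
  have hχ := sub_five_mul_eq_chi12Int_mul (f := fun j => thetaSeries12 j w)
    (fun j => thetaSeries12_add j w) (fun j => thetaSeries12_neg j w) c
  push_cast at hden him hχ
  have h1 := jacobiTheta₂_twelfth_eq_quadGaussSum_mul hdet hw 1
  have h5 := jacobiTheta₂_twelfth_eq_quadGaussSum_mul hdet hw 5
  rw [hsqrt _ hden] at h1 h5
  rw [one_mul] at h1
  push_cast at h1 h5
  apply mul_left_cancel₀ (a := ((√12 : ℝ) : ℂ)) (by simp)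
  linear_combination sqrt_twelve_mul_eta him + h1 - h5 + (√12 : ℝ) / (√c : ℝ) *
    sqrtNegI (c * w + 24 * D) * quadGaussSum c A *
      (hχ - chi12Int (c : ZMod 12) * eta_eq_thetaSeries12 hw)

end QuadraticGaussSum

section SquareModulus

variable {c : ℕ} [NeZero c]

lemma natCast_sq_eq_zero (c : ℕ) : (c : ZMod (c ^ 2)) ^ 2 = 0 := by
  exact_mod_cast ZMod.natCast_self (c ^ 2)

lemma natCast_mul_eq_zero_iff_dvd_val {b : ZMod (c ^ 2)} :
    (c : ZMod (c ^ 2)) * b = 0 ↔ c ∣ b.val := by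
  have hdvd (n : ℕ) : c ^ 2 ∣ c * n ↔ c ∣ n := by
    rw [sq, Nat.mul_dvd_mul_iff_left (NeZero.pos c)]
  rw [← hdvd, ← ZMod.natCast_eq_zero_iff, Nat.cast_mul, ZMod.natCast_zmod_val]

lemma natCast_mul_eq_zero_iff {b : ZMod (c ^ 2)} :
    (c : ZMod (c ^ 2)) * b = 0 ↔ ∃ v : ZMod c, ((c * v.val : ℕ) : ZMod (c ^ 2)) = b := by
  refine ⟨fun h => ?_, ?_⟩
  · obtain ⟨v, hv⟩ := natCast_mul_eq_zero_iff_dvd_val.mp h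
    have hlt : v < c := by
      have := hv ▸ b.val_lt
      exact lt_of_mul_lt_mul_left (this.trans_eq (sq c)) c.zero_le
    exact ⟨v, by rw [ZMod.val_natCast_of_lt hlt, ← hv, ZMod.natCast_zmod_val]⟩
  · rintro ⟨v, rfl⟩
    rw [Nat.cast_mul, ← mul_assoc, ← sq, natCast_sq_eq_zero, zero_mul]

lemma natCast_mul_val_injective :
    Function.Injective fun v : ZMod c => ((c * v.val : ℕ) : ZMod (c ^ 2)) := fun u v h => by
  simp only [ZMod.natCast_eq_natCast_iff, sq] at h
  have := Nat.ModEq.mul_left_cancel' (NeZero.ne c) h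
  rwa [← ZMod.natCast_eq_natCast_iff, ZMod.natCast_zmod_val, ZMod.natCast_zmod_val] at this

lemma sum_natCast_mul_eq_zero {M : Type*} [AddCommMonoid M] (φ : ZMod (c ^ 2) → M) :
    ∑ b with (c : ZMod (c ^ 2)) * b = 0, φ b =
      ∑ v : ZMod c, φ ((c * v.val : ℕ) : ZMod (c ^ 2)) := by
  rw [← Finset.sum_image fun _ _ _ _ h => natCast_mul_val_injective h]
  congr 1
  ext b
  simp [natCast_mul_eq_zero_iff]

lemma quadGaussSum_sq (hc : Odd c) {A : ZMod (c ^ 2)} (hA : IsUnit A) :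
    quadGaussSum (c ^ 2) A = c := by
  have h2 : IsUnit (2 : ZMod (c ^ 2)) := by
    exact_mod_cast (ZMod.isUnit_iff_coprime 2 (c ^ 2)).mpr (hc.pow.coprime_two_left)
  -- Translating `j` by `cv` multiplies the summand by a character of `v`, trivial iff `cj = 0`.
  have hshift (v : ZMod (c ^ 2)) : quadGaussSum (c ^ 2) A =
      ∑ j : ZMod (c ^ 2), ZMod.stdAddChar (A * j ^ 2) *
        ZMod.stdAddChar (v * (2 * A * ((c : ZMod (c ^ 2)) * j))) := by
    rw [quadGaussSum, ← Equiv.sum_comp (Equiv.addRight ((c : ZMod (c ^ 2)) * v))]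
    refine Finset.sum_congr rfl fun j _ => ?_
    rw [← AddChar.map_add_eq_mul, Equiv.coe_addRight]
    congr 1
    linear_combination A * v ^ 2 * natCast_sq_eq_zero c
  have hsum_v (j : ZMod (c ^ 2)) : ZMod.stdAddChar (A * j ^ 2) *
      ∑ v : ZMod (c ^ 2), ZMod.stdAddChar (v * (2 * A * ((c : ZMod (c ^ 2)) * j))) =
        if (c : ZMod (c ^ 2)) * j = 0 then ((c ^ 2 : ℕ) : ℂ) else 0 := by
    rw [AddChar.sum_mulShift _ (ZMod.isPrimitive_stdAddChar (c ^ 2)), ZMod.card]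
    simp only [(h2.mul hA).mul_right_eq_zero]
    split_ifs with hj
    · obtain ⟨v, rfl⟩ := natCast_mul_eq_zero_iff.mp hj
      rw [Nat.cast_mul, mul_pow, natCast_sq_eq_zero, zero_mul, mul_zero, AddChar.map_zero_eq_one,
        one_mul]
    · simp
  have hne : ((c ^ 2 : ℕ) : ℂ) ≠ 0 := NeZero.ne _
  refine mul_left_cancel₀ hne ?_
  calc ((c ^ 2 : ℕ) : ℂ) * quadGaussSum (c ^ 2) A
      = ∑ _v : ZMod (c ^ 2), quadGaussSum (c ^ 2) A := by simp
    _ = ∑ j : ZMod (c ^ 2), ZMod.stdAddChar (A * j ^ 2) *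
          ∑ v : ZMod (c ^ 2), ZMod.stdAddChar (v * (2 * A * ((c : ZMod (c ^ 2)) * j))) := by
        rw [Finset.sum_congr rfl fun v _ => hshift v, Finset.sum_comm]
        simp_rw [Finset.mul_sum]
    _ = ∑ j : ZMod (c ^ 2) with (c : ZMod (c ^ 2)) * j = 0, ((c ^ 2 : ℕ) : ℂ) := by
        rw [Finset.sum_filter, Finset.sum_congr rfl fun j _ => hsum_v j]
    _ = ((c ^ 2 : ℕ) : ℂ) * c := by
        rw [sum_natCast_mul_eq_zero]
        simp [mul_comm]

end SquareModulus

section LegendreGaussSum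

variable (ℓ : ℕ) [Fact ℓ.Prime]

/-- The Legendre symbol modulo `ℓ` as a complex-valued character. -/
noncomputable def legendreChar : MulChar (ZMod ℓ) ℂ :=
  (quadraticChar (ZMod ℓ)).ringHomComp (Int.castRingHom ℂ)

/-- The Gauss sum of the Legendre symbol. -/
noncomputable def legendreGaussSum : ℂ := gaussSum (legendreChar ℓ) ZMod.stdAddChar

variable {ℓ}

lemma legendreChar_intCast (n : ℤ) : legendreChar ℓ (n : ZMod ℓ) = legendreSym ℓ n := rfl

lemma legendreChar_isQuadratic : (legendreChar ℓ).IsQuadratic :=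
  (quadraticChar_isQuadratic (ZMod ℓ)).comp _

lemma ringChar_zmod_ne_two (hℓ : ℓ ≠ 2) : ringChar (ZMod ℓ) ≠ 2 := by
  rwa [ZMod.ringChar_zmod_n]

lemma legendreChar_ne_one (hℓ : ℓ ≠ 2) : legendreChar ℓ ≠ 1 := by
  rw [legendreChar, MulChar.ringHomComp_ne_one_iff (RingHom.injective_int _)]
  exact quadraticChar_ne_one (ringChar_zmod_ne_two hℓ)

lemma legendreGaussSum_sq (hℓ : ℓ ≠ 2) :
    legendreGaussSum ℓ ^ 2 = legendreChar ℓ (-1) * ℓ := by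
  have := gaussSum_sq (legendreChar_ne_one hℓ) legendreChar_isQuadratic
    (ZMod.isPrimitive_stdAddChar ℓ)
  rwa [ZMod.card] at this

lemma sum_legendreChar_mul_stdAddChar (hℓ : ℓ ≠ 2) (n : ZMod ℓ) :
    ∑ u : ZMod ℓ, legendreChar ℓ u * ZMod.stdAddChar (n * u) =
      legendreChar ℓ n * legendreGaussSum ℓ := by
  rcases eq_or_ne n 0 with rfl | hn
  · simp [MulChar.sum_eq_zero_of_ne_one (legendreChar_ne_one hℓ), MulChar.map_zero]
  · have h := gaussSum_mulShift_eq (legendreChar ℓ) (ZMod.stdAddChar (N := ℓ)) (Units.mk0 n hn)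
    rw [legendreChar_isQuadratic.inv] at h
    simpa [gaussSum, legendreGaussSum, AddChar.mulShift_apply] using h

lemma card_sq_eq (hℓ : ℓ ≠ 2) (x : ZMod ℓ) :
    ((Finset.univ.filter fun j : ZMod ℓ => j ^ 2 = x).card : ℂ) = legendreChar ℓ x + 1 := by
  have h := quadraticChar_card_sqrts (ringChar_zmod_ne_two hℓ) x
  rw [Set.toFinset_ofPred] at h
  simp only [legendreChar, MulChar.ringHomComp_apply, eq_intCast]
  exact_mod_cast congrArg (Int.cast : ℤ → ℂ) h

lemma quadGaussSum_prime (hℓ : ℓ ≠ 2) {A : ZMod ℓ} (hA : A ≠ 0) :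
    quadGaussSum ℓ A = legendreChar ℓ A * legendreGaussSum ℓ := by
  have hfiber (x : ZMod ℓ) : ∑ j : ZMod ℓ with j ^ 2 = x, ZMod.stdAddChar (A * j ^ 2) =
      (legendreChar ℓ x + 1) * ZMod.stdAddChar (A * x) := by
    rw [← card_sq_eq hℓ, ← nsmul_eq_mul, ← Finset.sum_const]
    exact Finset.sum_congr rfl fun j hj => by rw [(Finset.mem_filter.mp hj).2]
  have hortho : ∑ x : ZMod ℓ, ZMod.stdAddChar (A * x) = (0 : ℂ) := by
    simpa [hA, mul_comm] using AddChar.sum_mulShift A (ZMod.isPrimitive_stdAddChar ℓ)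
  rw [quadGaussSum, ← Finset.sum_fiberwise_of_maps_to (t := Finset.univ)
    (g := fun j : ZMod ℓ => j ^ 2) (fun _ _ => Finset.mem_univ _),
    Finset.sum_congr rfl fun x _ => hfiber x]
  simp_rw [add_mul, one_mul]
  rw [Finset.sum_add_distrib, hortho, add_zero, sum_legendreChar_mul_stdAddChar hℓ]

lemma isUnit_zmod_prime_sq_iff {b : ZMod (ℓ ^ 2)} :
    IsUnit b ↔ ¬ (ℓ : ZMod (ℓ ^ 2)) * b = 0 := by
  have hp : ℓ.Prime := Fact.out
  rw [natCast_mul_eq_zero_iff_dvd_val, ← hp.coprime_iff_not_dvd, Nat.coprime_comm,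
    ← Nat.coprime_pow_right_iff two_pos, ← ZMod.isUnit_iff_coprime, ZMod.natCast_zmod_val]

lemma sum_zmod_prime_sq {M : Type*} [AddCommMonoid M] (φ : ZMod (ℓ ^ 2) → M) :
    ∑ b, φ b = ∑ u : (ZMod (ℓ ^ 2))ˣ, φ u + ∑ v : ZMod ℓ, φ ((ℓ * v.val : ℕ) : ZMod (ℓ ^ 2)) := by
  rw [← Finset.sum_filter_not_add_sum_filter _ fun b => (ℓ : ZMod (ℓ ^ 2)) * b = 0,
    sum_natCast_mul_eq_zero, ← Finset.sum_image (g := Units.val) fun _ _ _ _ h => Units.ext h]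
  congr 2
  ext b
  simp [← isUnit_zmod_prime_sq_iff, IsUnit]

end LegendreGaussSum

/-! ### The forms `η^r F` -/

section EtaForm

variable {r m k : ℕ}

/-- The form `η(w)^r F(w)` of weight `r / 2 + m` on the full modular group. -/
noncomputable def etaForm (r : ℕ) (F : ModularForm 𝒮ℒ (m : ℤ)) (w : ℍ) : ℂ :=
  eta (w : ℂ) ^ r * F w

lemma coe_SL_smul (γ : SL(2, ℤ)) (τ : ℍ) :
    ((γ • τ : ℍ) : ℂ) = ((γ 0 0 : ℤ) * (τ : ℂ) + (γ 0 1 : ℤ)) /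
      ((γ 1 0 : ℤ) * (τ : ℂ) + (γ 1 1 : ℤ)) := by
  rw [UpperHalfPlane.coe_specialLinearGroup_apply]
  simp

lemma SL_denom_ne_zero (γ : SL(2, ℤ)) (τ : ℍ) :
    ((γ 1 0 : ℤ) * (τ : ℂ) + (γ 1 1 : ℤ)) ≠ 0 := by
  simpa only [← ModularGroup.denom_apply] using denom_ne_zero _ τ

lemma modularForm_SL_smul {n : ℤ} {G : Type*} [FunLike G ℍ ℂ] [SlashInvariantFormClass G 𝒮ℒ n]
    (F : G) (γ : SL(2, ℤ)) (τ : ℍ) :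
    F (γ • τ) = ((γ 1 0 : ℤ) * (τ : ℂ) + (γ 1 1 : ℤ)) ^ n * F τ := by
  rw [← ModularGroup.denom_apply]
  exact SlashInvariantForm.slash_action_eqn'' F
    (γ := Matrix.SpecialLinearGroup.mapGL ℝ γ) (MonoidHom.mem_range.mpr ⟨γ, rfl⟩) τ

lemma eta_pow_SL_smul (γ : SL(2, ℤ)) (τ : ℍ) :
    eta (γ • τ : ℍ) ^ 24 = ((γ 1 0 : ℤ) * (τ : ℂ) + (γ 1 1 : ℤ)) ^ 12 * eta τ ^ 24 :=
  modularForm_SL_smul CuspForm.discriminant γ τ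

lemma mdifferentiable_eta : MDifferentiable 𝓘(ℂ) 𝓘(ℂ) (fun w : ℍ => eta (w : ℂ)) := by
  rw [UpperHalfPlane.mdifferentiable_iff]
  refine .congr (fun z hz =>
    (differentiableAt_eta_of_mem_upperHalfPlaneSet hz).differentiableWithinAt) fun z hz => ?_
  simp [ofComplex_apply_of_im_pos hz]

lemma mdifferentiable_etaForm (F : ModularForm 𝒮ℒ (m : ℤ)) :
    MDifferentiable 𝓘(ℂ) 𝓘(ℂ) (etaForm r F) :=
  (mdifferentiable_eta.pow r).mul F.holo'

lemma zeroAtFilter_of_pow {α R : Type*} [SeminormedRing R] [NormMulClass R] [NormOneClass R]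
    {l : Filter α} {f : α → R} (n : ℕ) (h : ZeroAtFilter l fun x => f x ^ n) :
    ZeroAtFilter l f := by
  rw [ZeroAtFilter, Metric.tendsto_nhds] at h ⊢
  intro ε hε
  filter_upwards [h (ε ^ n) (by positivity)] with x hx
  rw [dist_zero_right, norm_pow] at hx
  rw [dist_zero_right]
  exact lt_of_pow_lt_pow_left₀ n hε.le hx

lemma zeroAtFilter_pow {α : Type*} {l : Filter α} {f : α → ℂ} {n : ℕ} (hn : n ≠ 0)
    (h : ZeroAtFilter l f) : ZeroAtFilter l fun x => f x ^ n := by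
  rw [ZeroAtFilter, ← zero_pow hn]
  exact h.pow n

lemma isZeroAtImInfty_etaForm (hr : r ≠ 0) (F : ModularForm 𝒮ℒ (m : ℤ)) :
    IsZeroAtImInfty (etaForm r F) :=
  (zeroAtFilter_pow hr (zeroAtFilter_of_pow 24 discriminant_isZeroAtImInfty)).mul_boundedAtFilter
    (ModularFormClass.bdd_at_infty F)

section Cusps

lemma etaForm_pow_SL_smul (F : ModularForm 𝒮ℒ (m : ℤ)) (γ : SL(2, ℤ)) (τ : ℍ) :
    etaForm r F (γ • τ) ^ 24 =
      ((γ 1 0 : ℤ) * (τ : ℂ) + (γ 1 1 : ℤ)) ^ (12 * (r + 2 * m)) * etaForm r F τ ^ 24 := by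
  rw [etaForm, etaForm, modularForm_SL_smul F, mul_pow, pow_right_comm, eta_pow_SL_smul,
    zpow_natCast]
  generalize ((γ 1 0 : ℤ) : ℂ) * (τ : ℂ) + ((γ 1 1 : ℤ) : ℂ) = J
  ring

lemma etaForm_pow_slash (F : ModularForm 𝒮ℒ (m : ℤ)) (γ : SL(2, ℤ)) :
    (fun w => etaForm r F w ^ 24) ∣[(12 * (r + 2 * m : ℕ) : ℤ)] γ =
      fun w => etaForm r F w ^ 24 := by
  funext τ
  have hJ := SL_denom_ne_zero γ τ
  rw [SL_slash_apply, ModularGroup.denom_apply, etaForm_pow_SL_smul, zpow_neg]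
  norm_cast at hJ ⊢
  field_simp

lemma isZeroAt_etaForm_pow (hr : r ≠ 0) (F : ModularForm 𝒮ℒ (m : ℤ)) {c : OnePoint ℝ}
    (hc : IsCusp c 𝒮ℒ) :
    c.IsZeroAt (fun w => etaForm r F w ^ 24) (12 * (r + 2 * m : ℕ)) := by
  rw [OnePoint.isZeroAt_iff_forall_SL2Z hc]
  intro γ _
  rw [etaForm_pow_slash]
  exact zeroAtFilter_pow (by norm_num) (isZeroAtImInfty_etaForm hr F)

/-- The matrix `(24 0; 0 1)`, which acts on the upper half-plane as `mul24`. It is taken over `ℚ`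
because rational matrices permute the cusps `ℚ ∪ {∞}`. -/
noncomputable def dilation24 : GL (Fin 2) ℚ :=
  Matrix.GeneralLinearGroup.mkOfDetNeZero !![24, 0; 0, 1] (by simp)

lemma isCusp_dilation24_smul (γ : SL(2, ℤ)) :
    IsCusp (dilation24.map (Rat.castHom ℝ) • Matrix.SpecialLinearGroup.mapGL ℝ γ •
      (OnePoint.infty : OnePoint ℝ)) 𝒮ℒ := by
  have hmap : (Matrix.SpecialLinearGroup.mapGL ℚ γ).map (Rat.castHom ℝ) =
      Matrix.SpecialLinearGroup.mapGL ℝ γ := by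
    ext i j
    simp
  rw [isCusp_SL2Z_iff]
  refine ⟨dilation24 • Matrix.SpecialLinearGroup.mapGL ℚ γ • OnePoint.infty, ?_⟩
  rw [← Rat.coe_castHom, OnePoint.map_smul, OnePoint.map_smul, OnePoint.map_infty, hmap]

lemma det_dilation24 : (dilation24.map (Rat.castHom ℝ)).det.val = 24 := by
  simp [dilation24, Matrix.GeneralLinearGroup.mkOfDetNeZero, Matrix.det_fin_two]

lemma denom_dilation24 (τ : ℍ) : denom (dilation24.map (Rat.castHom ℝ)) τ = 1 := by
  simp [denom, dilation24, Matrix.GeneralLinearGroup.mkOfDetNeZero]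

lemma dilation24_smul (τ : ℍ) : dilation24.map (Rat.castHom ℝ) • τ = mul24 τ := by
  ext
  rw [coe_smul_of_det_pos (det_dilation24 ▸ by norm_num), denom_dilation24, div_one, coe_mul24]
  simp [num, dilation24, Matrix.GeneralLinearGroup.mkOfDetNeZero]

lemma slash_dilation24 (f : ℍ → ℂ) (n : ℤ) :
    f ∣[n] dilation24.map (Rat.castHom ℝ) = (24 : ℂ) ^ (n - 1) • fun τ => f (mul24 τ) := by
  funext τ
  simp only [slash_def, dilation24_smul, denom_dilation24, σ, det_dilation24]
  simp [mul_comm]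

lemma halfSlash_pow_two_mul (f : ℍ → ℂ) (n : ℕ) (γ : SL(2, ℤ)) :
    (fun τ => halfSlash k f γ τ ^ (2 * n)) =
      (fun τ => f τ ^ (2 * n)) ∣[(n * (2 * k + 1 : ℕ) : ℤ)] γ := by
  funext τ
  rw [SL_slash_apply, ModularGroup.denom_apply, halfSlash, mul_pow, mul_comm]
  have hsqrt : (((γ 1 0 : ℤ) * (τ : ℂ) + (γ 1 1 : ℤ)) ^ (1 / 2 : ℂ)) ^ (2 : ℤ) =
      (γ 1 0 : ℤ) * (τ : ℂ) + (γ 1 1 : ℤ) := by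
    rw [zpow_ofNat, ← Complex.cpow_nat_mul]
    simp
  congr 1
  nth_rewrite 2 [← hsqrt]
  rw [← zpow_natCast, ← zpow_mul, ← zpow_mul]
  congr 1
  push_cast
  ring

lemma isZeroAtImInfty_halfSlash_etaForm (hr : r ≠ 0) (hk : 2 * k + 1 = r + 2 * m)
    (F : ModularForm 𝒮ℒ (m : ℤ)) (γ : SL(2, ℤ)) :
    IsZeroAtImInfty (halfSlash k (fun τ => etaForm r F (mul24 τ)) γ) := by
  have h := isZeroAt_etaForm_pow hr F (isCusp_dilation24_smul γ)
  rw [OnePoint.IsZeroAt.smul_iff, OnePoint.IsZeroAt.smul_iff, OnePoint.isZeroAt_infty_iff,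
    slash_dilation24] at h
  change IsZeroAtImInfty (((_ : ℂ) • (_ : ℍ → ℂ)) ∣[(_ : ℤ)] γ) at h
  rw [SL_smul_slash] at h
  have h24 : (24 : ℂ) ^ (12 * (r + 2 * m : ℕ) - 1 : ℤ) ≠ 0 := zpow_ne_zero _ (by norm_num)
  refine zeroAtFilter_of_pow (2 * 12) ?_
  rw [halfSlash_pow_two_mul, hk, ← inv_smul_smul₀ h24 (_ ∣[_] γ)]
  exact h.smul _

end Cusps

section ThetaMultiplier

lemma modularForm_mul24_smul {n : ℤ} (F : ModularForm 𝒮ℒ n) {γ : SL(2, ℤ)}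
    (hγ : γ ∈ CongruenceSubgroup.Gamma0 24) (τ : ℍ) :
    F (mul24 (γ • τ)) = ((γ 1 0 : ℤ) * (τ : ℂ) + (γ 1 1 : ℤ)) ^ n * F (mul24 τ) := by
  rw [CongruenceSubgroup.Gamma0_mem, ZMod.intCast_zmod_eq_zero_iff_dvd] at hγ
  obtain ⟨c, hc⟩ := hγ
  push_cast at hc
  -- Conjugating `(a b; 24c d)` by `mul24` gives `(a 24b; c d)`.
  let γ' : SL(2, ℤ) := ⟨!![γ 0 0, 24 * γ 0 1; c, γ 1 1], by
    rw [Matrix.det_fin_two_of]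
    linear_combination det_fin_two_eq_one γ + γ 0 1 * hc⟩
  have hconj : mul24 (γ • τ) = γ' • mul24 τ := by
    ext
    rw [coe_mul24, coe_SL_smul, coe_SL_smul, coe_mul24, hc]
    simp [γ']
    ring_nf
  rw [hconj, modularForm_SL_smul F, coe_mul24, hc]
  congr 2
  simp [γ']
  ring

lemma isThetaInvariant_etaForm (hr : Odd r) (hm : Even m) (hk : 2 * k + 1 = r + 2 * m)
    (F : ModularForm 𝒮ℒ (m : ℤ)) :
    IsThetaInvariant k 576 chi12 (fun τ => etaForm r F (mul24 τ)) := by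
  intro γ hγ τ
  obtain ⟨κ, hκ, hθ, hη⟩ := exists_factor_theta_eta hγ τ
  obtain ⟨n, rfl⟩ := hm
  have hχ : chi12 ((γ 1 1 : ℤ) : ZMod 576) ^ r = chi12 ((γ 1 1 : ℤ) : ZMod 576) := by
    rw [chi12_intCast]
    exact_mod_cast chi12Int_pow_of_odd _ hr
  have hJ : ((γ 1 0 : ℤ) * (τ : ℂ) + (γ 1 1 : ℤ)) ^ (n + n) = κ ^ (2 * (n + n)) := by
    rw [← two_mul, pow_mul, ← hκ, ← pow_mul]
    ring
  have hγ24 : γ ∈ CongruenceSubgroup.Gamma0 24 := by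
    rw [CongruenceSubgroup.Gamma0_mem, ZMod.intCast_zmod_eq_zero_iff_dvd] at hγ ⊢
    exact .trans (by norm_num) hγ
  simp only [etaForm]
  rw [hη, modularForm_mul24_smul F hγ24, hθ, zpow_natCast, hJ, mul_pow, mul_pow, hχ, mul_pow, hk,
    pow_add κ]
  ring

end ThetaMultiplier

lemma mdifferentiable_comp_mul24 {f : ℍ → ℂ} (hf : MDifferentiable 𝓘(ℂ) 𝓘(ℂ) f) :
    MDifferentiable 𝓘(ℂ) 𝓘(ℂ) (fun τ => f (mul24 τ)) := by
  rw [UpperHalfPlane.mdifferentiable_iff] at hf ⊢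
  have hmap : Set.MapsTo (fun z : ℂ => 24 * z) {z | 0 < z.im} {z | 0 < z.im} := fun z hz => by
    simpa using hz
  refine (hf.comp (g := f ∘ ofComplex) (by fun_prop) hmap).congr fun z hz => ?_
  simp only [Function.comp_apply]
  rw [ofComplex_apply_of_im_pos hz, ofComplex_apply_of_im_pos (hmap hz)]
  rfl

lemma etaSpace_le_cuspForms (hr : Odd r) (hm : Even m) (hk : 2 * k + 1 = r + 2 * m) :
    etaSpace r m ≤ cuspForms k 576 chi12 := by
  rintro g ⟨F, hF⟩
  obtain rfl : g = fun τ => etaForm r F (mul24 τ) := funext hF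
  exact ⟨mdifferentiable_comp_mul24 (mdifferentiable_etaForm F),
    isThetaInvariant_etaForm hr hm hk F,
    isZeroAtImInfty_halfSlash_etaForm hr.pos.ne' hk F⟩

end EtaForm

/-! ### Hecke operators -/

section HeckeSeries

variable {a : ℕ → ℂ} {h : ℂ → ℂ} {w : ℂ}

lemma im_div_natCast_pos (c : ℕ) [NeZero c] (hw : 0 < w.im) : 0 < (w / c).im := by
  have : 0 < c := NeZero.pos c
  rw [div_natCast_im]
  positivity

lemma im_add_div_pos (c : ℕ) [NeZero c] (hw : 0 < w.im) (n : ℕ) :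
    0 < ((w + 24 * n) / c).im :=
  im_div_natCast_pos c (by simpa using hw)

/-- The expansion `h(w) = ∑ a(n) exp(2πi n w / 24)` on the upper half-plane, so that `h(24τ)` has
the `q`-expansion `∑ a(n) q^n`. -/
def HasExpansion24 (a : ℕ → ℂ) (h : ℂ → ℂ) : Prop :=
  ∀ w : ℂ, 0 < w.im → HasSum (fun n : ℕ => a n * cexp (2 * Real.pi * I * n * (w / 24))) (h w)

section Modulus

variable {c : ℕ} [NeZero c]

/-- The sum of `h((w + 24b)/c)` over `b` modulo `c`; up to the factor `c`, this is the operator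
`U_c`, in the variable `w = 24τ`. -/
noncomputable def shiftSum (c : ℕ) [NeZero c] (h : ℂ → ℂ) (w : ℂ) : ℂ :=
  ∑ b : ZMod c, h ((w + 24 * b.val) / c)

/-- The sum of `ψ(v) h((w + 24v)/c)` over `v` modulo `c`. -/
noncomputable def charShiftSum (ψ : MulChar (ZMod c) ℂ) (h : ℂ → ℂ) (w : ℂ) : ℂ :=
  ∑ v : ZMod c, ψ v * h ((w + 24 * v.val) / c)

lemma injective_natCast_mul_left (c : ℕ) [NeZero c] : Function.Injective fun n : ℕ => c * n :=
  mul_right_injective₀ (NeZero.ne c)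

lemma exp_shift (n : ℕ) (b : ZMod c) :
    cexp (2 * Real.pi * I * n * ((w + 24 * b.val) / c / 24)) =
      cexp (2 * Real.pi * I * n * (w / 24 / c)) * ZMod.stdAddChar (b * (n : ZMod c)) := by
  have hc : (c : ℂ) ≠ 0 := NeZero.ne _
  have hchar := ZMod.stdAddChar_coe (N := c) (b.val * n)
  push_cast [ZMod.natCast_zmod_val] at hchar
  rw [hchar, ← Complex.exp_add]
  congr 1
  field_simp

lemma sum_exp_shift (n : ℕ) :
    (c : ℂ)⁻¹ * ∑ b : ZMod c, cexp (2 * Real.pi * I * n * ((w + 24 * b.val) / c / 24)) =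
      if c ∣ n then cexp (2 * Real.pi * I * n * (w / 24 / c)) else 0 := by
  have hc : (c : ℂ) ≠ 0 := NeZero.ne _
  simp_rw [exp_shift, ← Finset.mul_sum]
  rw [AddChar.sum_mulShift _ (ZMod.isPrimitive_stdAddChar c), ZMod.card]
  simp only [ZMod.natCast_eq_zero_iff]
  split_ifs
  · field_simp
  · simp

lemma HasExpansion24.hasSum_shiftSum (hah : HasExpansion24 a h) (hw : 0 < w.im) :
    HasSum (fun n : ℕ => a (c * n) * cexp (2 * Real.pi * I * n * (w / 24)))
      ((c : ℂ)⁻¹ * shiftSum c h w) := by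
  have hc : (c : ℂ) ≠ 0 := NeZero.ne _
  have hsum := (hasSum_sum (s := Finset.univ) fun (b : ZMod c) _ =>
    hah _ (im_add_div_pos c hw b.val)).mul_left (c : ℂ)⁻¹
  simp_rw [← Finset.mul_sum, mul_left_comm _ (a _), sum_exp_shift, mul_ite, mul_zero] at hsum
  refine (((injective_natCast_mul_left c).hasSum_iff fun n hn => ?_).mpr hsum).congr_fun
    fun n => ?_
  · exact if_neg fun ⟨j, hj⟩ => hn ⟨j, hj.symm⟩
  · rw [Function.comp_apply, if_pos (dvd_mul_right _ _)]
    congr 2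
    push_cast
    field_simp

lemma HasExpansion24.hasSum_natCast_mul (hah : HasExpansion24 a h) (hw : 0 < w.im) :
    HasSum (fun n : ℕ => (if c ∣ n then a (n / c) else 0) *
      cexp (2 * Real.pi * I * n * (w / 24))) (h (c * w)) := by
  refine ((injective_natCast_mul_left c).hasSum_iff fun n hn => ?_).mp
    ((hah _ (im_natCast_mul_pos c hw)).congr_fun fun n => ?_)
  · rw [if_neg fun ⟨j, hj⟩ => hn ⟨j, hj.symm⟩, zero_mul]
  · rw [Function.comp_apply, if_pos (dvd_mul_right _ _), Nat.mul_div_cancel_left _ (NeZero.pos c)]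
    congr 2
    push_cast
    ring

end Modulus

section Legendre

variable {ℓ : ℕ} [Fact ℓ.Prime]

lemma legendreChar_sq {v : ZMod ℓ} (hv : v ≠ 0) : legendreChar ℓ v ^ 2 = 1 := by
  rw [legendreChar, MulChar.ringHomComp_apply, ← map_pow, quadraticChar_sq_one hv, map_one]

lemma legendreGaussSum_ne_zero (hℓ : ℓ ≠ 2) : legendreGaussSum ℓ ≠ 0 := by
  have hleg : legendreChar ℓ (-1) ≠ 0 := (isUnit_one.neg.map (legendreChar ℓ)).ne_zero
  rw [← pow_ne_zero_iff two_ne_zero, legendreGaussSum_sq hℓ]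
  exact mul_ne_zero hleg (NeZero.ne _)

lemma HasExpansion24.hasSum_legendre (hℓ : ℓ ≠ 2) (hah : HasExpansion24 a h) (hw : 0 < w.im) :
    HasSum (fun n : ℕ => legendreChar ℓ n * a n * cexp (2 * Real.pi * I * n * (w / 24)))
      ((legendreGaussSum ℓ)⁻¹ * charShiftSum (legendreChar ℓ) h (ℓ * w)) := by
  have hg := legendreGaussSum_ne_zero hℓ
  have hℓ0 : (ℓ : ℂ) ≠ 0 := NeZero.ne _
  refine ((hasSum_sum (s := Finset.univ) fun (u : ZMod ℓ) _ =>
    (hah _ (im_add_div_pos ℓ (im_natCast_mul_pos ℓ hw) u.val)).mul_left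
      (legendreChar ℓ u)).mul_left (legendreGaussSum ℓ)⁻¹).congr_fun fun n => ?_
  have hfactor (u : ZMod ℓ) : legendreChar ℓ u * (a n * cexp (2 * Real.pi * I * n *
      ((ℓ * w + 24 * u.val) / ℓ / 24))) = a n * cexp (2 * Real.pi * I * n * (w / 24)) *
        (legendreChar ℓ u * ZMod.stdAddChar ((n : ZMod ℓ) * u)) := by
    rw [exp_shift, mul_div_assoc, mul_div_cancel_left₀ _ hℓ0, mul_comm u]
    ring
  simp_rw [hfactor, ← Finset.mul_sum, sum_legendreChar_mul_stdAddChar hℓ]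
  field_simp

end Legendre

section HeckeSum

variable {ℓ : ℕ} [Fact ℓ.Prime]

/-- The Hecke operator `T(ℓ²)` in weight `k + 1/2` and character `χ₁₂`, in the variable `w = 24τ`,
as a combination of `U_{ℓ²}`, the twist by the Legendre symbol and the dilation by `ℓ²`. -/
noncomputable def heckeSum (k ℓ : ℕ) [Fact ℓ.Prime] (h : ℂ → ℂ) (w : ℂ) : ℂ :=
  ((ℓ : ℂ) ^ 2)⁻¹ * shiftSum (ℓ ^ 2) h w +
    chi12Int ℓ * legendreChar ℓ (-1) ^ k * (ℓ : ℂ) ^ ((k : ℤ) - 1) * (legendreGaussSum ℓ)⁻¹ *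
      charShiftSum (legendreChar ℓ) h (ℓ * w) +
    (ℓ : ℂ) ^ (2 * (k : ℤ) - 1) * h (ℓ ^ 2 * w)

lemma coprime_prime_twelve (hℓ : 3 < ℓ) : Nat.Coprime ℓ 12 := by
  have hp : ℓ.Prime := Fact.out
  have h2 : Nat.Coprime ℓ 2 := (Nat.coprime_primes hp Nat.prime_two).mpr (by lia)
  have h3 : Nat.Coprime ℓ 3 := (Nat.coprime_primes hp Nat.prime_three).mpr (by lia)
  exact (h2.pow_right 2).mul_right h3

lemma chi12Int_sq_eq_one {a : ZMod 12} (ha : IsUnit a) : chi12Int a ^ 2 = 1 := by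
  decide +revert

lemma chi12Int_prime_sq (hℓ : 3 < ℓ) : chi12Int (ℓ : ZMod 12) ^ 2 = 1 :=
  chi12Int_sq_eq_one ((ZMod.isUnit_iff_coprime ℓ 12).mpr (coprime_prime_twelve hℓ))

lemma hasExpansion24_heckeSum (k : ℕ) (hℓ : 3 < ℓ) {g : ℍ → ℂ}
    (hah : HasExpansion24 (qCoeff g) h) :
    HasExpansion24 (heckeCoeff k chi12 ℓ g) (heckeSum k ℓ h) := by
  intro w hw
  have hU := hah.hasSum_shiftSum (c := ℓ ^ 2) hw
  have hV := (hah.hasSum_legendre (ℓ := ℓ) (by lia) hw).mul_left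
    (chi12Int ℓ * legendreChar ℓ (-1) ^ k * (ℓ : ℂ) ^ ((k : ℤ) - 1))
  have hdil := (hah.hasSum_natCast_mul (c := ℓ ^ 2) hw).mul_left ((ℓ : ℂ) ^ (2 * (k : ℤ) - 1))
  rw [Nat.cast_pow] at hU hdil
  rw [heckeSum, mul_assoc _ (legendreGaussSum ℓ)⁻¹]
  refine ((hU.add hV).add hdil).congr_fun fun n => ?_
  have hleg : (legendreSym ℓ ((-1) ^ k * (n : ℤ)) : ℂ) =
      legendreChar ℓ (-1) ^ k * legendreChar ℓ n := by
    rw [← legendreChar_intCast]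
    push_cast
    rw [map_mul, map_pow]
  have hχ : chi12 (ℓ : ZMod 576) = chi12Int (ℓ : ZMod 12) := by exact_mod_cast chi12_intCast ℓ
  have hχ_sq : chi12 ((ℓ ^ 2 : ℕ) : ZMod 576) = 1 := by
    rw [Nat.cast_pow, map_pow, hχ]
    exact_mod_cast chi12Int_prime_sq hℓ
  rw [heckeCoeff, hleg, hχ, hχ_sq]
  ring

end HeckeSum

end HeckeSeries

section HeckeInversion

variable {r n : ℕ} {h : ℂ → ℂ} {w : ℂ}

/-- The automorphy factor of `w ↦ -1/w` for the forms `η^r F` with `F` of weight `2n`. -/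
noncomputable def inversionFactor (r n : ℕ) (w : ℂ) : ℂ := (-1) ^ n * sqrtNegI w ^ (r + 4 * n)

/-- The transformation laws of the forms `η^r F`, with `F` of level one and weight `2n`, under
those Möbius transformations which link the summands of a Hecke operator at `w` and `-1/w`. -/
structure EtaTransforms (r n : ℕ) (h : ℂ → ℂ) : Prop where
  add_int : ∀ w : ℂ, 0 < w.im → ∀ j : ℤ, h (w + 24 * j) = h w
  moebius : ∀ (c : ℕ) [NeZero c] (A B D : ℤ), 24 * A * (24 * D) - B * c = 1 →
    ∀ w : ℂ, 0 < w.im → h ((24 * A * w + B) / (c * w + 24 * D)) =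
      chi12Int (c : ZMod 12) * (quadGaussSum c (A : ZMod c) / √c) ^ r *
        inversionFactor r n (c * w + 24 * D) * h w

section EtaForm

variable {m : ℕ}

lemma inversionFactor_eq (r n : ℕ) (w : ℂ) :
    inversionFactor r n w = sqrtNegI w ^ r * w ^ (2 * n) := by
  have hsign : (-1 : ℂ) ^ n * (-1) ^ n = 1 := by rw [← mul_pow]; simp
  rw [inversionFactor, pow_add, sqrtNegI_pow_four_mul]
  linear_combination sqrtNegI w ^ r * w ^ (2 * n) * hsign

lemma ofComplex_moebius (γ : SL(2, ℤ)) (hw : 0 < w.im) :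
    ofComplex (((γ 0 0 : ℤ) * w + (γ 0 1 : ℤ)) / ((γ 1 0 : ℤ) * w + (γ 1 1 : ℤ))) =
      γ • ofComplex w := by
  have h := coe_SL_smul γ ⟨w, hw⟩
  rw [UpperHalfPlane.coe_mk] at h
  rw [← h, ofComplex_apply, ofComplex_apply_of_im_pos hw]

lemma etaForm_ofComplex_moebius (F : ModularForm 𝒮ℒ (m : ℤ)) {a b c d : ℤ}
    (hdet : a * d - b * c = 1) (hw : 0 < w.im) :
    etaForm r F (ofComplex ((a * w + b) / (c * w + d))) =
      eta ((a * w + b) / (c * w + d)) ^ r * ((c * w + d) ^ m * F (ofComplex w)) := by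
  let γ : SL(2, ℤ) := ⟨!![a, b; c, d], by rwa [Matrix.det_fin_two_of]⟩
  have hsmul : ofComplex ((a * w + b) / (c * w + d)) = γ • ofComplex w := by
    simpa [γ] using ofComplex_moebius γ hw
  have hcoe : ((γ • ofComplex w : ℍ) : ℂ) = (a * w + b) / (c * w + d) := by
    rw [← hsmul, ofComplex_apply_of_im_pos]
    exact im_moebius_pos (by rw [← hdet, mul_comm b]) hw
  rw [etaForm, hsmul, hcoe, modularForm_SL_smul F, ofComplex_apply_of_im_pos hw]
  simp [γ]

lemma eta_add_intCast (w : ℂ) (j : ℤ) :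
    eta (w + j) = cexp (2 * Real.pi * I * j / 24) * eta w := by
  have hq : Function.Periodic.qParam 1 (w + j) = Function.Periodic.qParam 1 w := by
    rw [Function.Periodic.qParam, Function.Periodic.qParam,
      ← Complex.exp_periodic.int_mul j (2 * Real.pi * I * w / (1 : ℝ))]
    congr 1
    push_cast
    ring
  have hq24 : Function.Periodic.qParam 24 (w + j) =
      cexp (2 * Real.pi * I * j / 24) * Function.Periodic.qParam 24 w := by
    rw [Function.Periodic.qParam, Function.Periodic.qParam, ← Complex.exp_add]
    congr 1
    push_cast
    ring
  simp only [eta, eta_q, hq, hq24]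
  ring

lemma etaForm_ofComplex_add_intCast (F : ModularForm 𝒮ℒ (m : ℤ)) (hw : 0 < w.im) (j : ℤ) :
    etaForm r F (ofComplex (w + j)) =
      cexp (2 * Real.pi * I * j / 24) ^ r * etaForm r F (ofComplex w) := by
  have h := etaForm_ofComplex_moebius (r := r) F (a := 1) (b := j) (c := 0) (d := 1) (by simp) hw
  simp only [Int.cast_one, Int.cast_zero, one_mul, zero_mul, zero_add, div_one, one_pow] at h
  rw [h, eta_add_intCast, etaForm, ofComplex_apply_of_im_pos hw, UpperHalfPlane.coe_mk]
  ring

lemma etaTransforms_etaForm (hr : Odd r) (F : ModularForm 𝒮ℒ ((n + n : ℕ) : ℤ)) :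
    EtaTransforms r n (fun w => etaForm r F (ofComplex w)) where
  add_int w hw j := by
    have h := etaForm_ofComplex_add_intCast (r := r) F hw (24 * j)
    have hexp : cexp (2 * Real.pi * I * (24 * j : ℤ) / 24) = 1 := by
      rw [← Complex.exp_int_mul_two_pi_mul_I j]
      congr 1
      push_cast
      ring
    rw [hexp, one_pow, one_mul] at h
    exact_mod_cast h
  moebius c _ A B D hdet w hw := by
    have hχ : (chi12Int (c : ZMod 12) : ℂ) ^ r = chi12Int (c : ZMod 12) := by
      exact_mod_cast chi12Int_pow_of_odd _ hr
    have h := etaForm_ofComplex_moebius (r := r) F hdet hw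
    push_cast at h
    rw [h, eta_moebius_eq_quadGaussSum_mul hdet hw, inversionFactor_eq, mul_pow, mul_pow, mul_pow,
      hχ, etaForm, ofComplex_apply_of_im_pos hw, UpperHalfPlane.coe_mk]
    ring

end EtaForm

section Inversion

lemma isUnit_neg_576 {c : ℕ} (hc : Nat.Coprime c 12) : IsUnit (-576 : ZMod c) := by
  have h576 : Nat.Coprime 576 c := (hc.pow_right 3).symm.coprime_dvd_left (by norm_num)
  exact_mod_cast ((ZMod.isUnit_iff_coprime 576 c).mpr h576).neg

variable {c : ℕ} [NeZero c]

lemma inversionFactor_ofReal_mul {x : ℝ} (hx : 0 < x) (hw : w ≠ 0) :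
    inversionFactor r n (x * w) = (√x : ℂ) ^ (r + 4 * n) * inversionFactor r n w := by
  rw [inversionFactor, inversionFactor, sqrtNegI_ofReal_mul hx hw, mul_pow]
  ring

lemma inversionFactor_natCast_mul (hw : w ≠ 0) :
    inversionFactor r n (c * w) = (√c : ℂ) ^ (r + 4 * n) * inversionFactor r n w :=
  mod_cast inversionFactor_ofReal_mul (x := c) (mod_cast NeZero.pos c) hw

lemma inversionFactor_natCast_sq_mul (hw : w ≠ 0) :
    inversionFactor r n (c ^ 2 * w) = (c : ℂ) ^ (r + 4 * n) * inversionFactor r n w := by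
  have h := inversionFactor_ofReal_mul (r := r) (n := n) (x := (c : ℝ) ^ 2)
    (pow_pos (mod_cast NeZero.pos c) 2) hw
  rw [Real.sqrt_sq (Nat.cast_nonneg c)] at h
  exact_mod_cast h

lemma EtaTransforms.eq_of_natCast_eq (hh : EtaTransforms r n h) {a b : ℕ}
    (hab : (a : ZMod c) = b) (hw : 0 < w.im) : h ((w + 24 * a) / c) = h ((w + 24 * b) / c) := by
  have hc : (c : ℂ) ≠ 0 := NeZero.ne _
  obtain ⟨j, hj⟩ := (ZMod.natCast_eq_natCast_iff a b c).mp hab |>.dvd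
  have hj' : (b : ℂ) - a = c * j := by exact_mod_cast hj
  rw [← hh.add_int _ (im_add_div_pos c hw a) j]
  congr 1
  field_simp
  linear_combination -24 * hj'

lemma exists_det_eq_one {a d : ZMod c} (had : 576 * a * d = -1) :
    ∃ B : ℤ, 24 * (a.val : ℤ) * (24 * -(d.val : ℤ)) - B * c = 1 := by
  have hzero : ((576 * a.val * d.val + 1 : ℤ) : ZMod c) = 0 := by
    push_cast [ZMod.natCast_zmod_val]
    rw [had, neg_add_cancel]
  obtain ⟨B, hB⟩ := (ZMod.intCast_zmod_eq_zero_iff_dvd _ c).mp hzero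
  exact ⟨-B, by linarith⟩

lemma EtaTransforms.neg_one_div_add_div (hh : EtaTransforms r n h) {a d : ZMod c}
    (had : 576 * a * d = -1) (hw : 0 < w.im) :
    h ((-1 / w + 24 * a.val) / c) =
      chi12Int (c : ZMod 12) * (quadGaussSum c a / √c) ^ r * inversionFactor r n w *
        h ((w + 24 * d.val) / c) := by
  have hw0 := ne_zero_of_im_pos hw
  have hc : (c : ℂ) ≠ 0 := NeZero.ne _
  obtain ⟨B, hB⟩ := exists_det_eq_one had
  have hBC : 24 * (a.val : ℂ) * (24 * -(d.val : ℂ)) - B * c = 1 := by exact_mod_cast hB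
  have h_moebius := hh.moebius c a.val B (-(d.val : ℤ)) hB _ (im_add_div_pos c hw d.val)
  push_cast [ZMod.natCast_zmod_val] at h_moebius
  have hdenom : (c : ℂ) * ((w + 24 * d.val) / c) + 24 * -(d.val : ℂ) = w := by
    field_simp
    ring
  rw [hdenom] at h_moebius
  rw [← h_moebius]
  congr 1
  field_simp
  linear_combination hBC

lemma EtaTransforms.neg_one_div (hh : EtaTransforms r n h) (hw : 0 < w.im) :
    h (-1 / w) = inversionFactor r n w * h w := by
  have h_one := hh.neg_one_div_add_div (c := 1) (a := 0) (d := 0) (Subsingleton.elim _ _) hw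
  have hG : quadGaussSum 1 0 = 1 := by simp [quadGaussSum]
  simpa [hG] using h_one

lemma EtaTransforms.apply_neg_one_div_div_sq (hh : EtaTransforms r n h) (hw : 0 < w.im) :
    h (-1 / w / c ^ 2) = c ^ (r + 4 * n) * inversionFactor r n w * h (c ^ 2 * w) := by
  have hpos : 0 < ((c : ℂ) ^ 2 * w).im := mod_cast im_natCast_mul_pos (c ^ 2) hw
  rw [div_div, mul_comm w, hh.neg_one_div hpos,
    inversionFactor_natCast_sq_mul (ne_zero_of_im_pos hw)]

lemma EtaTransforms.apply_sq_mul_neg_one_div (hh : EtaTransforms r n h) (hw : 0 < w.im) :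
    (c : ℂ) ^ (r + 4 * n) * h (c ^ 2 * (-1 / w)) = inversionFactor r n w * h (w / c ^ 2) := by
  have hc0 : (c : ℂ) ≠ 0 := NeZero.ne _
  have hpos : 0 < (w / (c : ℂ) ^ 2).im := mod_cast im_div_natCast_pos (c ^ 2) hw
  have harg : (c : ℂ) ^ 2 * (-1 / w) = -1 / (w / c ^ 2) := by field_simp
  rw [harg, hh.neg_one_div hpos, ← mul_assoc,
    ← inversionFactor_natCast_sq_mul (ne_zero_of_im_pos hpos),
    mul_div_cancel₀ _ (pow_ne_zero 2 hc0)]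

lemma sum_mulChar_mul {R S : Type*} [CommRing R] [Fintype R] [Fintype Rˣ] [CommRing S]
    (ψ : MulChar R S) (f : R → S) : ∑ v, ψ v * f v = ∑ u : Rˣ, ψ u * f u :=
  (Fintype.sum_of_injective Units.val Units.val_injective _ _
    (fun _ hv => by rw [ψ.map_nonunit hv, zero_mul]) fun _ => rfl).symm

/-- The inversion interchanges the residues `v` and `-1/(576v)`, whence the characters `ψ` and
`ψ⁻¹φ`, where `φ` is the character through which the Gauss sum depends on the residue. -/
lemma EtaTransforms.charShiftSum_neg_one_div (hh : EtaTransforms r n h) (hr : Odd r)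
    (hc : Nat.Coprime c 12) {φ : MulChar (ZMod c) ℂ} (hφ : φ.IsQuadratic) {G : ℂ}
    (hG : ∀ u : (ZMod c)ˣ, quadGaussSum c u = φ u * G) (ψ : MulChar (ZMod c) ℂ) (hw : 0 < w.im) :
    charShiftSum ψ h (-1 / w) = chi12Int (c : ZMod 12) * (G / √c) ^ r * (ψ⁻¹ * φ) (-576) *
      inversionFactor r n w * charShiftSum (ψ⁻¹ * φ) h w := by
  let s : (ZMod c)ˣ := (isUnit_neg_576 hc).unit
  let e : (ZMod c)ˣ ≃ (ZMod c)ˣ := (Equiv.mulLeft s).trans (Equiv.inv _)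
  have hs : (s : ZMod c) = -576 := rfl
  have hse (u : (ZMod c)ˣ) : s * e u = u⁻¹ := by simp [e]
  have he (u : (ZMod c)ˣ) : (576 : ZMod c) * u * (e u : ZMod c) = -1 := by
    have hone : (s : ZMod c) * u * e u = 1 := by
      rw [← Units.val_mul, ← Units.val_mul, mul_right_comm, hse, inv_mul_cancel, Units.val_one]
    linear_combination hs * u * e u - hone
  have hφr (u : (ZMod c)ˣ) : φ u ^ r = φ u := by
    rw [← MulChar.pow_apply_coe, hφ.pow_odd hr]
  have hchar (u : (ZMod c)ˣ) : ψ u * φ u = (ψ⁻¹ * φ) (-576) * (ψ⁻¹ * φ) (e u) := by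
    rw [← map_mul, ← hs, ← Units.val_mul, hse, ← Ring.inverse_unit, ← MulChar.inv_apply, mul_inv,
      inv_inv, hφ.inv, MulChar.mul_apply]
  rw [charShiftSum, charShiftSum, sum_mulChar_mul, sum_mulChar_mul,
    ← e.sum_comp fun u => (ψ⁻¹ * φ) u * h ((w + 24 * (u : ZMod c).val) / c), Finset.mul_sum]
  refine Finset.sum_congr rfl fun u _ => ?_
  rw [hh.neg_one_div_add_div (he u) hw, hG, mul_div_assoc, mul_pow, hφr]
  linear_combination chi12Int (c : ZMod 12) * (G / √c) ^ r * inversionFactor r n w *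
    h ((w + 24 * (e u : ZMod c).val) / c) * hchar u

end Inversion

lemma ofReal_sqrt_natCast_sq (c : ℕ) : (√c : ℂ) ^ 2 = c :=
  mod_cast Real.sq_sqrt (Nat.cast_nonneg c)

lemma ofReal_sqrt_natCast_ne_zero (c : ℕ) [NeZero c] : (√c : ℂ) ≠ 0 :=
  mod_cast (Real.sqrt_pos.mpr (mod_cast NeZero.pos c)).ne'

section HeckeSumInversion

variable {ℓ k : ℕ} [Fact ℓ.Prime]

lemma sum_eq_zero_apply_add_sum_one_mul {F S : Type*} [Field F] [Fintype F] [CommRing S]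
    (f : F → S) : ∑ v, f v = f 0 + ∑ v, (1 : MulChar F S) v * f v := by
  classical
  have hsplit (v : F) : f v = (if v = 0 then f v else 0) + (1 : MulChar F S) v * f v := by
    rcases eq_or_ne v 0 with rfl | hv
    · rw [if_pos rfl, MulChar.map_zero, zero_mul, add_zero]
    · rw [if_neg hv, zero_add, MulChar.one_apply hv.isUnit, one_mul]
  rw [Finset.sum_congr rfl fun v _ => hsplit v, Finset.sum_add_distrib, Finset.sum_ite_eq',
    if_pos (Finset.mem_univ _)]

lemma EtaTransforms.shiftSum_prime_sq (hh : EtaTransforms r n h) (hw : 0 < w.im) :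
    shiftSum (ℓ ^ 2) h w = h (w / ℓ ^ 2) + charShiftSum (1 : MulChar (ZMod ℓ) ℂ) h (w / ℓ) +
      charShiftSum (1 : MulChar (ZMod (ℓ ^ 2)) ℂ) h w := by
  have hℓ0 : (ℓ : ℂ) ≠ 0 := NeZero.ne _
  have hmul (v : ZMod ℓ) : h ((w + 24 * ((ℓ * v.val : ℕ) : ZMod (ℓ ^ 2)).val) / (ℓ ^ 2 : ℕ)) =
      h ((w / ℓ + 24 * v.val) / ℓ) := by
    rw [hh.eq_of_natCast_eq (ZMod.natCast_zmod_val _) hw]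
    congr 1
    push_cast
    field_simp
  have hzero : h (w / ℓ ^ 2) = h ((w / ℓ + 24 * (0 : ZMod ℓ).val) / ℓ) := by
    congr 1
    rw [ZMod.val_zero, Nat.cast_zero, mul_zero, add_zero, div_div, sq]
  rw [shiftSum, sum_zmod_prime_sq, charShiftSum, hzero,
    ← sum_eq_zero_apply_add_sum_one_mul fun v : ZMod ℓ => h ((w / ℓ + 24 * v.val) / ℓ),
    charShiftSum, sum_mulChar_mul, add_comm]
  simp only [hmul, MulChar.one_apply_coe, one_mul]

lemma EtaTransforms.charShiftSum_prime_neg_one_div (hh : EtaTransforms r n h) (hr : Odd r)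
    (hℓ : 3 < ℓ) (ψ : MulChar (ZMod ℓ) ℂ) (hw : 0 < w.im) :
    charShiftSum ψ h (-1 / w) =
      chi12Int (ℓ : ZMod 12) * (legendreGaussSum ℓ / √ℓ) ^ r * (ψ⁻¹ * legendreChar ℓ) (-576) *
        inversionFactor r n w * charShiftSum (ψ⁻¹ * legendreChar ℓ) h w :=
  hh.charShiftSum_neg_one_div hr (coprime_prime_twelve hℓ) legendreChar_isQuadratic
    (fun u => quadGaussSum_prime (by lia) u.ne_zero) ψ hw

lemma EtaTransforms.charShiftSum_one_prime_sq_neg_one_div (hh : EtaTransforms r n h) (hr : Odd r)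
    (hℓ : 3 < ℓ) (hw : 0 < w.im) :
    charShiftSum (1 : MulChar (ZMod (ℓ ^ 2)) ℂ) h (-1 / w) =
      inversionFactor r n w * charShiftSum (1 : MulChar (ZMod (ℓ ^ 2)) ℂ) h w := by
  have hℓ0 : (ℓ : ℂ) ≠ 0 := NeZero.ne _
  have hcop : Nat.Coprime (ℓ ^ 2) 12 := (coprime_prime_twelve hℓ).pow_left 2
  have hodd : Odd ℓ := (Fact.out : ℓ.Prime).odd_of_ne_two (by lia)
  have h_inv := hh.charShiftSum_neg_one_div hr hcop
    (MulChar.isQuadratic_iff_sq_eq_one.mpr (one_pow 2)) (G := ℓ)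
    (fun u => by rw [quadGaussSum_sq hodd u.isUnit, MulChar.one_apply_coe, one_mul]) 1 hw
  have hχ : (chi12Int ((ℓ ^ 2 : ℕ) : ZMod 12) : ℂ) = 1 := by
    rw [Nat.cast_pow, map_pow]
    exact_mod_cast chi12Int_prime_sq hℓ
  have hsqrt : √((ℓ ^ 2 : ℕ) : ℝ) = ℓ := by
    rw [Nat.cast_pow, Real.sqrt_sq (Nat.cast_nonneg ℓ)]
  rw [hχ, hsqrt, ofReal_natCast, div_self hℓ0, one_pow, inv_one, one_mul, one_mul,
    mul_one, MulChar.one_apply (isUnit_neg_576 hcop), one_mul] at h_inv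
  exact h_inv

lemma legendreChar_neg_one_mul_self : legendreChar ℓ (-1) * legendreChar ℓ (-1) = 1 := by
  rw [← sq, legendreChar_sq (neg_ne_zero.mpr one_ne_zero)]

lemma legendreChar_neg_576 (hℓ : 3 < ℓ) : legendreChar ℓ (-576) = legendreChar ℓ (-1) := by
  have h24 : (24 : ZMod ℓ) ≠ 0 := by
    intro h24
    refine (isUnit_neg_576 (coprime_prime_twelve hℓ)).ne_zero ?_
    linear_combination -24 * h24
  rw [show (-576 : ZMod ℓ) = -1 * 24 ^ 2 by norm_num, map_mul, map_pow, legendreChar_sq h24,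
    mul_one]

variable (n) in
lemma twistCoeff_eq (hr : Odd r) (hℓ : 3 < ℓ) (hk : 2 * k + 1 = r + 4 * n) :
    chi12Int (ℓ : ZMod 12) * legendreChar ℓ (-1) ^ k * (ℓ : ℂ) ^ ((k : ℤ) - 1) *
      (legendreGaussSum ℓ)⁻¹ = ((ℓ : ℂ) ^ 2)⁻¹ * (chi12Int (ℓ : ZMod 12) * legendreChar ℓ (-1) *
        legendreGaussSum ℓ ^ r * ℓ ^ (2 * n)) := by
  obtain ⟨j, rfl⟩ := hr
  obtain rfl : k = j + 2 * n := by lia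
  have hℓ0 : (ℓ : ℂ) ≠ 0 := NeZero.ne _
  have hg := legendreGaussSum_ne_zero (ℓ := ℓ) (by lia)
  have hg_pow : legendreGaussSum ℓ ^ (2 * j + 1) * legendreGaussSum ℓ =
      (legendreChar ℓ (-1) * ℓ) ^ (j + 1) := by
    rw [← legendreGaussSum_sq (by lia)]
    ring
  have hsign : legendreChar ℓ (-1) ^ (j + 2 * n) = legendreChar ℓ (-1) ^ (j + 2) := by
    simp only [pow_add, pow_mul, sq, legendreChar_neg_one_mul_self, one_pow]
  rw [hsign, zpow_sub_one₀ hℓ0, zpow_natCast]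
  field_simp
  linear_combination -(chi12Int (ℓ : ZMod 12) * legendreChar ℓ (-1) * (ℓ : ℂ) ^ (2 * n)) * hg_pow

lemma twistCoeff_mul (hr : Odd r) (hℓ : 3 < ℓ) (hk : 2 * k + 1 = r + 4 * n) :
    chi12Int (ℓ : ZMod 12) * legendreChar ℓ (-1) ^ k * (ℓ : ℂ) ^ ((k : ℤ) - 1) *
      (legendreGaussSum ℓ)⁻¹ * (chi12Int (ℓ : ZMod 12) * legendreGaussSum ℓ ^ r) =
        ((ℓ : ℂ) ^ 2)⁻¹ * ℓ ^ (r + 2 * n) := by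
  have hχ : (chi12Int (ℓ : ZMod 12) : ℂ) ^ 2 = 1 := by exact_mod_cast chi12Int_prime_sq hℓ
  have hg_pow : legendreGaussSum ℓ ^ r * legendreGaussSum ℓ ^ r =
      legendreChar ℓ (-1) * ℓ ^ r := by
    rw [← mul_pow, ← sq, legendreGaussSum_sq (by lia), mul_pow, ← MulChar.pow_apply' _ hr.pos.ne',
      legendreChar_isQuadratic.pow_odd hr]
  rw [twistCoeff_eq n hr hℓ hk]
  calc _ = ((ℓ : ℂ) ^ 2)⁻¹ * (chi12Int (ℓ : ZMod 12) : ℂ) ^ 2 * legendreChar ℓ (-1) *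
        ℓ ^ (2 * n) * (legendreGaussSum ℓ ^ r * legendreGaussSum ℓ ^ r) := by ring
    _ = ((ℓ : ℂ) ^ 2)⁻¹ * ℓ ^ (r + 2 * n) *
        (legendreChar ℓ (-1) * legendreChar ℓ (-1)) := by rw [hχ, hg_pow]; ring
    _ = _ := by rw [legendreChar_neg_one_mul_self, mul_one]

lemma EtaTransforms.charShiftSum_one_neg_one_div_div (hh : EtaTransforms r n h) (hr : Odd r)
    (hℓ : 3 < ℓ) (hw : 0 < w.im) :
    charShiftSum (1 : MulChar (ZMod ℓ) ℂ) h (-1 / w / ℓ) =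
      chi12Int (ℓ : ZMod 12) * legendreChar ℓ (-1) * legendreGaussSum ℓ ^ r * ℓ ^ (2 * n) *
        inversionFactor r n w * charShiftSum (legendreChar ℓ) h (ℓ * w) := by
  have hpow : (legendreGaussSum ℓ / √ℓ) ^ r * (√ℓ : ℂ) ^ (r + 4 * n) =
      legendreGaussSum ℓ ^ r * ℓ ^ (2 * n) := by
    rw [← ofReal_sqrt_natCast_sq, div_pow, div_mul_eq_mul_div,
      div_eq_iff (pow_ne_zero _ (ofReal_sqrt_natCast_ne_zero ℓ))]
    ring
  rw [div_div, mul_comm w, hh.charShiftSum_prime_neg_one_div hr hℓ 1 (im_natCast_mul_pos ℓ hw),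
    inv_one, one_mul, legendreChar_neg_576 hℓ, inversionFactor_natCast_mul (ne_zero_of_im_pos hw)]
  linear_combination chi12Int (ℓ : ZMod 12) * legendreChar ℓ (-1) * inversionFactor r n w *
    charShiftSum (legendreChar ℓ) h (ℓ * w) * hpow

lemma EtaTransforms.charShiftSum_legendreChar_mul_neg_one_div (hh : EtaTransforms r n h)
    (hr : Odd r) (hℓ : 3 < ℓ) (hw : 0 < w.im) :
    (ℓ : ℂ) ^ (r + 2 * n) * charShiftSum (legendreChar ℓ) h (ℓ * (-1 / w)) =
      chi12Int (ℓ : ZMod 12) * legendreGaussSum ℓ ^ r * inversionFactor r n w *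
        charShiftSum (1 : MulChar (ZMod ℓ) ℂ) h (w / ℓ) := by
  have hℓ0 : (ℓ : ℂ) ≠ 0 := NeZero.ne _
  have hpos : 0 < (w / (ℓ : ℂ)).im := im_div_natCast_pos ℓ hw
  have harg : (ℓ : ℂ) * (-1 / w) = -1 / (w / ℓ) := by field_simp
  have hfactor : inversionFactor r n w = (√ℓ : ℂ) ^ (r + 4 * n) * inversionFactor r n (w / ℓ) := by
    rw [← inversionFactor_natCast_mul (ne_zero_of_im_pos hpos), mul_div_cancel₀ _ hℓ0]
  have hpow : (legendreGaussSum ℓ / √ℓ) ^ r * (ℓ : ℂ) ^ (r + 2 * n) =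
      legendreGaussSum ℓ ^ r * (√ℓ : ℂ) ^ (r + 4 * n) := by
    rw [← ofReal_sqrt_natCast_sq, div_pow, div_mul_eq_mul_div,
      div_eq_iff (pow_ne_zero _ (ofReal_sqrt_natCast_ne_zero ℓ))]
    ring
  have hunit : IsUnit (-576 : ZMod ℓ) := isUnit_neg_576 (coprime_prime_twelve hℓ)
  rw [harg, hh.charShiftSum_prime_neg_one_div hr hℓ _ hpos, inv_mul_cancel,
    MulChar.one_apply hunit, hfactor]
  linear_combination chi12Int (ℓ : ZMod 12) * inversionFactor r n (w / ℓ) *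
    charShiftSum (1 : MulChar (ZMod ℓ) ℂ) h (w / ℓ) * hpow

/-- Inverting `w` exchanges the dilates `h(w/ℓ²)` and `h(ℓ²w)` as well as the trivial and the
quadratic shifts modulo `ℓ`, and it fixes the shifts by units modulo `ℓ²`. -/
lemma EtaTransforms.heckeSum_neg_one_div (hh : EtaTransforms r n h) (hr : Odd r) (hℓ : 3 < ℓ)
    (hk : 2 * k + 1 = r + 4 * n) (hw : 0 < w.im) :
    heckeSum k ℓ h (-1 / w) = inversionFactor r n w * heckeSum k ℓ h w := by
  have hℓ0 : (ℓ : ℂ) ≠ 0 := NeZero.ne _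
  have hzpow : (ℓ : ℂ) ^ (2 * (k : ℤ) - 1) = ((ℓ : ℂ) ^ 2)⁻¹ * ℓ ^ (r + 4 * n) := by
    rw [← hk, eq_inv_mul_iff_mul_eq₀ (pow_ne_zero 2 hℓ0), ← zpow_natCast, ← zpow_natCast,
      ← zpow_add₀ hℓ0]
    congr 1
    push_cast
    ring
  have htriv := hh.charShiftSum_one_neg_one_div_div hr hℓ hw
  have hleg := hh.charShiftSum_legendreChar_mul_neg_one_div hr hℓ hw
  have hcoeff := twistCoeff_mul hr hℓ hk
  rw [twistCoeff_eq n hr hℓ hk] at hcoeff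
  have htwist : ((ℓ : ℂ) ^ 2)⁻¹ * (chi12Int (ℓ : ZMod 12) * legendreChar ℓ (-1) *
      legendreGaussSum ℓ ^ r * ℓ ^ (2 * n)) * charShiftSum (legendreChar ℓ) h (ℓ * (-1 / w)) =
        ((ℓ : ℂ) ^ 2)⁻¹ * inversionFactor r n w *
          charShiftSum (1 : MulChar (ZMod ℓ) ℂ) h (w / ℓ) := by
    refine mul_left_cancel₀ (pow_ne_zero (r + 2 * n) hℓ0) ?_
    linear_combination ((ℓ : ℂ) ^ 2)⁻¹ * (chi12Int (ℓ : ZMod 12) * legendreChar ℓ (-1) *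
      legendreGaussSum ℓ ^ r * ℓ ^ (2 * n)) * hleg +
        inversionFactor r n w * charShiftSum (1 : MulChar (ZMod ℓ) ℂ) h (w / ℓ) * hcoeff
  rw [heckeSum, heckeSum, twistCoeff_eq n hr hℓ hk, hzpow, hh.shiftSum_prime_sq hw,
    hh.shiftSum_prime_sq (im_neg_one_div_pos hw), hh.apply_neg_one_div_div_sq hw,
    hh.charShiftSum_one_prime_sq_neg_one_div hr hℓ hw]
  linear_combination ((ℓ : ℂ) ^ 2)⁻¹ * htriv + htwist +
    ((ℓ : ℂ) ^ 2)⁻¹ * hh.apply_sq_mul_neg_one_div (c := ℓ) hw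

end HeckeSumInversion

end HeckeInversion

section HeckeStable

variable {a b : ℕ → ℂ} {h : ℂ → ℂ} {r m n k ℓ : ℕ}

section Support

lemma qParam_twentyFour_pow (w : ℂ) (n : ℕ) :
    Function.Periodic.qParam 24 w ^ n = cexp (2 * Real.pi * I * n * (w / 24)) := by
  rw [Function.Periodic.qParam, ← Complex.exp_nat_mul]
  congr 1
  push_cast
  ring

lemma eq_zero_of_hasSum_qParam {p : ℝ} (hp : 0 < p) {c : ℕ → ℂ}
    (hc : ∀ τ : ℍ, HasSum (fun j => c j • Function.Periodic.qParam p (τ : ℂ) ^ j) 0) : c = 0 := by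
  have hzero : cuspFunction p (0 : ℍ → ℂ) = 0 := by
    simpa [cuspFunction, Function.Periodic.cuspFunction]
      using! (tendsto_const_nhds.mono_left nhdsWithin_le_nhds).limUnder_eq
  have hball := hasFPowerSeriesOnBall_cuspFunction (f := 0) hp (hzero ▸ analyticAt_const) hc
  rw [hzero] at hball
  exact (FormalMultilinearSeries.ofScalars_series_eq_zero ℂ).mp hball.hasFPowerSeriesAt.eq_zero

lemma HasExpansion24.unique (ha : HasExpansion24 a h) (hb : HasExpansion24 b h) : a = b := by
  refine sub_eq_zero.mp (eq_zero_of_hasSum_qParam (p := 24) (by norm_num) fun τ => ?_)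
  have hsub := (ha τ τ.im_pos).sub (hb τ τ.im_pos)
  simp_rw [← sub_mul, ← qParam_twentyFour_pow, sub_self] at hsub
  exact hsub

lemma HasExpansion24.comp_add_one (hah : HasExpansion24 a h) :
    HasExpansion24 (fun j => cexp (2 * Real.pi * I / 24) ^ j * a j) (fun w => h (w + 1)) := by
  intro w hw
  refine (hah (w + 1) (by simpa using hw)).congr_fun fun j => ?_
  beta_reduce
  rw [mul_comm (_ ^ _), mul_assoc, ← Complex.exp_nat_mul, ← Complex.exp_add]
  congr 2
  ring

lemma exp_div_24_pow_eq_iff {i j : ℕ} :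
    cexp (2 * Real.pi * I / 24) ^ i = cexp (2 * Real.pi * I / 24) ^ j ↔ i ≡ j [MOD 24] := by
  have hζ := Complex.isPrimitiveRoot_exp 24 (by norm_num)
  exact (IsOfFinOrder.pow_eq_pow_iff_modEq (hζ.isOfFinOrder (by norm_num))).trans
    (by rw [← hζ.eq_orderOf])

lemma HasExpansion24.modEq_of_add_one (hah : HasExpansion24 a h)
    (hT : ∀ w : ℂ, 0 < w.im → h (w + 1) = cexp (2 * Real.pi * I / 24) ^ r * h w) (hn : a n ≠ 0) :
    n ≡ r [MOD 24] := by
  have hmul : HasExpansion24 (fun j => cexp (2 * Real.pi * I / 24) ^ r * a j)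
      (fun w => h (w + 1)) := by
    intro w hw
    beta_reduce
    simpa only [hT w hw, mul_assoc] using (hah w hw).mul_left (cexp (2 * Real.pi * I / 24) ^ r)
  exact exp_div_24_pow_eq_iff.mp (mul_right_cancel₀ hn (congrFun (hah.comp_add_one.unique hmul) n))

lemma HasExpansion24.add_one (hah : HasExpansion24 a h) (ha : ∀ j, a j ≠ 0 → j ≡ r [MOD 24])
    {w : ℂ} (hw : 0 < w.im) : h (w + 1) = cexp (2 * Real.pi * I / 24) ^ r * h w := by
  refine (hah.comp_add_one w hw).unique (((hah w hw).mul_left _).congr_fun fun j => ?_)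
  beta_reduce
  rcases eq_or_ne (a j) 0 with hj | hj
  · rw [hj, mul_zero, zero_mul, mul_zero]
  · rw [exp_div_24_pow_eq_iff.mpr (ha j hj), mul_assoc]

lemma prime_sq_modEq_one [Fact ℓ.Prime] (hℓ : 3 < ℓ) : ℓ ^ 2 ≡ 1 [MOD 24] := by
  have hsq : ∀ x : ZMod 24, IsUnit x → x ^ 2 = 1 := by decide
  have hcop : Nat.Coprime ℓ 24 :=
    ((coprime_prime_twelve hℓ).pow_right 2).coprime_dvd_right (by norm_num)
  rw [← ZMod.natCast_eq_natCast_iff]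
  exact_mod_cast hsq ℓ ((ZMod.isUnit_iff_coprime ℓ 24).mpr hcop)

lemma heckeCoeff_modEq [Fact ℓ.Prime] (hℓ : 3 < ℓ) {N : ℕ} {χ : DirichletCharacter ℂ N}
    {g : ℍ → ℂ} (hg : ∀ j, qCoeff g j ≠ 0 → j ≡ r [MOD 24]) (hn : heckeCoeff k χ ℓ g n ≠ 0) :
    n ≡ r [MOD 24] := by
  have hsq (j : ℕ) : ℓ ^ 2 * j ≡ j [MOD 24] := by
    simpa using (prime_sq_modEq_one hℓ).mul_right j
  contrapose! hn
  have hmul : qCoeff g (ℓ ^ 2 * n) = 0 := by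
    by_contra hne
    exact hn ((hsq n).symm.trans (hg _ hne))
  have hself : qCoeff g n = 0 := by
    by_contra hne
    exact hn (hg _ hne)
  have hdiv : (if ℓ ^ 2 ∣ n then qCoeff g (n / ℓ ^ 2) else 0) = 0 := by
    rw [ite_eq_right_iff]
    rintro ⟨j, rfl⟩
    rw [Nat.mul_div_cancel_left _ (pow_pos (Fact.out : ℓ.Prime).pos 2)]
    by_contra hne
    exact hn ((hsq j).trans (hg _ hne))
  rw [heckeCoeff, hmul, hself, hdiv, mul_zero, mul_zero, add_zero, add_zero]

end Support

section EtaFormExpansion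

lemma etaForm_mul24_eq (F : ModularForm 𝒮ℒ (m : ℤ)) (τ : ℍ) :
    etaForm r F (mul24 τ) = etaForm r F (ofComplex (24 * (τ : ℂ))) := by
  rw [← coe_mul24, ofComplex_apply]

lemma periodic_etaForm_mul24 (F : ModularForm 𝒮ℒ (m : ℤ)) :
    Function.Periodic ((fun τ => etaForm r F (mul24 τ)) ∘ ofComplex) ((1 : ℝ) : ℂ) := by
  intro z
  simp only [Function.comp_apply]
  by_cases hz : 0 < z.im
  · have hz_add : 0 < (z + ((1 : ℝ) : ℂ)).im := by simpa using hz
    have hexp : cexp (2 * Real.pi * I * (24 : ℤ) / 24) = 1 := by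
      rw [← Complex.exp_two_pi_mul_I]
      congr 1
      push_cast
      ring
    have hshift := etaForm_ofComplex_add_intCast (r := r) F (w := 24 * z) (by simpa using hz) 24
    rw [hexp, one_pow, one_mul] at hshift
    rw [etaForm_mul24_eq, etaForm_mul24_eq, ofComplex_apply_of_im_pos hz,
      ofComplex_apply_of_im_pos hz_add, UpperHalfPlane.coe_mk, UpperHalfPlane.coe_mk, ← hshift]
    congr 2
    push_cast
    ring
  · have hz_add : ¬ 0 < (z + ((1 : ℝ) : ℂ)).im := by simpa using hz
    rw [ofComplex_apply_of_im_nonpos (not_lt.mp hz),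
      ofComplex_apply_of_im_nonpos (not_lt.mp hz_add)]

lemma isZeroAtImInfty_comp_mul24 {f : ℍ → ℂ} (hf : IsZeroAtImInfty f) :
    IsZeroAtImInfty (fun τ => f (mul24 τ)) := by
  have him : UpperHalfPlane.im ∘ mul24 = fun τ : ℍ => 24 * τ.im := by
    funext τ
    rw [Function.comp_apply, ← coe_im, coe_mul24]
    simp
  refine hf.comp ?_
  rw [atImInfty, tendsto_comap_iff, him]
  exact tendsto_comap.const_mul_atTop (by norm_num)

lemma hasExpansion24_etaForm (hr : r ≠ 0) (F : ModularForm 𝒮ℒ (m : ℤ)) :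
    HasExpansion24 (qCoeff fun τ => etaForm r F (mul24 τ))
      (fun w => etaForm r F (ofComplex w)) := by
  intro w hw
  have hw24 : 0 < (w / 24).im := by simpa using hw
  have hsum := UpperHalfPlane.hasSum_qExpansion one_pos (periodic_etaForm_mul24 F)
    (mdifferentiable_comp_mul24 (mdifferentiable_etaForm F))
    (isZeroAtImInfty_comp_mul24 (isZeroAtImInfty_etaForm hr F)).boundedAtFilter ⟨w / 24, hw24⟩
  rw [etaForm_mul24_eq, UpperHalfPlane.coe_mk, mul_div_cancel₀ w (by norm_num)] at hsum
  refine hsum.congr_fun fun n => ?_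
  rw [Function.Periodic.qParam, ← Complex.exp_nat_mul, qCoeff, smul_eq_mul]
  congr 2
  push_cast
  ring

lemma qCoeff_etaForm_modEq (hr : r ≠ 0) (F : ModularForm 𝒮ℒ (m : ℤ))
    (hn : qCoeff (fun τ => etaForm r F (mul24 τ)) n ≠ 0) : n ≡ r [MOD 24] := by
  refine (hasExpansion24_etaForm hr F).modEq_of_add_one (fun w hw => ?_) hn
  simpa using etaForm_ofComplex_add_intCast (r := r) F hw 1

end EtaFormExpansion

section EtaQuotient

/-- The quotient `h / η^r`, for a function `h` on `ℂ`, as a function on the upper half-plane. -/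
noncomputable def etaQuotient (r : ℕ) (h : ℂ → ℂ) (τ : ℍ) : ℂ := h τ / eta (τ : ℂ) ^ r

lemma eta_pow_mul_etaQuotient (r : ℕ) (h : ℂ → ℂ) (τ : ℍ) :
    eta (τ : ℂ) ^ r * etaQuotient r h τ = h τ :=
  mul_div_cancel₀ _ (pow_ne_zero r (eta_ne_zero τ.im_pos))

lemma qParam_isBigO_eta :
    (fun τ : ℍ => Function.Periodic.qParam 24 (τ : ℂ)) =O[atImInfty] fun τ : ℍ => eta (τ : ℂ) := by
  refine Asymptotics.IsBigO.of_pow (n := 24) (by norm_num)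
    ((Asymptotics.isBigO_of_le _ fun τ => ?_).trans exp_isBigO_discriminant)
  rw [Pi.pow_apply, norm_pow, Function.Periodic.norm_qParam, ← Real.exp_nat_mul,
    Real.norm_of_nonneg (Real.exp_pos _).le]
  apply le_of_eq
  congr 1
  push_cast
  rw [coe_im]
  ring

lemma HasExpansion24.isBoundedAtImInfty (hah : HasExpansion24 a h)
    (ha : ∀ j, a j ≠ 0 → r ≤ j) : IsBoundedAtImInfty fun τ : ℍ =>
      (Function.Periodic.qParam 24 (τ : ℂ) ^ r)⁻¹ * h τ := by
  refine isBoundedAtImInfty_of_hasSum_qExpansion (h := 24) (c := fun j => a (j + r))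
    (by norm_num) fun τ => ?_
  have hq : Function.Periodic.qParam 24 (τ : ℂ) ≠ 0 := Complex.exp_ne_zero _
  have hsum := (hah τ τ.im_pos).mul_left (Function.Periodic.qParam 24 (τ : ℂ) ^ r)⁻¹
  refine (((add_left_injective r).hasSum_iff fun j hj => ?_).mpr hsum).congr_fun fun j => ?_
  · have hzero : a j = 0 := by
      by_contra hne
      exact hj ⟨j - r, Nat.sub_add_cancel (ha j hne)⟩
    rw [hzero, zero_mul, mul_zero]
  · rw [Function.comp_apply, ← qParam_twentyFour_pow, pow_add, smul_eq_mul]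
    field_simp

lemma isBoundedAtImInfty_etaQuotient (hah : HasExpansion24 a h) (ha : ∀ j, a j ≠ 0 → r ≤ j) :
    IsBoundedAtImInfty (etaQuotient r h) := by
  have hratio : IsBoundedAtImInfty fun τ : ℍ =>
      (eta (τ : ℂ) ^ r)⁻¹ * Function.Periodic.qParam 24 (τ : ℂ) ^ r := by
    refine (((Asymptotics.isBigO_refl (fun τ : ℍ => (eta (τ : ℂ) ^ r)⁻¹) _).mul
      (qParam_isBigO_eta.pow r)).congr_right fun τ => ?_).trans
      (Asymptotics.isBigO_const_const (1 : ℂ) (one_ne_zero' ℝ) atImInfty)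
    exact inv_mul_cancel₀ (pow_ne_zero r (eta_ne_zero τ.im_pos))
  refine Asymptotics.IsBigO.congr_left
    (Filter.BoundedAtFilter.mul hratio (hah.isBoundedAtImInfty ha)) fun τ => ?_
  have hq : Function.Periodic.qParam 24 (τ : ℂ) ^ r ≠ 0 := pow_ne_zero r (Complex.exp_ne_zero _)
  rw [Pi.mul_apply, etaQuotient, mul_assoc, mul_inv_cancel_left₀ hq, div_eq_inv_mul]

lemma mdifferentiable_etaQuotient (r : ℕ) (hh : DifferentiableOn ℂ h {z | 0 < z.im}) :
    MDifferentiable 𝓘(ℂ) 𝓘(ℂ) (etaQuotient r h) := by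
  have heta : DifferentiableOn ℂ (fun w => eta w ^ r) {z | 0 < z.im} := fun z hz =>
    ((differentiableAt_eta_of_mem_upperHalfPlaneSet hz).pow r).differentiableWithinAt
  rw [UpperHalfPlane.mdifferentiable_iff]
  refine (hh.div heta fun z hz => pow_ne_zero r (eta_ne_zero hz)).congr fun z hz => ?_
  rw [Function.comp_apply, etaQuotient, ofComplex_apply_of_im_pos hz]
  rfl

lemma etaQuotient_slash_T (k : ℤ)
    (hT : ∀ w : ℂ, 0 < w.im → h (w + 1) = cexp (2 * Real.pi * I / 24) ^ r * h w) :
    etaQuotient r h ∣[k] ModularGroup.T = etaQuotient r h := by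
  funext τ
  have heta := eta_add_intCast (τ : ℂ) 1
  rw [Int.cast_one, mul_one] at heta
  have hv : (((1 : ℝ) +ᵥ τ : ℍ) : ℂ) = τ + 1 := by
    rw [UpperHalfPlane.coe_vadd, ofReal_one, add_comm]
  rw [SL_slash_apply, modular_T_smul, etaQuotient, etaQuotient, hv, hT τ τ.im_pos, heta, mul_pow,
    mul_div_mul_left _ _ (pow_ne_zero _ (Complex.exp_ne_zero _)), ModularGroup.denom_apply]
  simp [ModularGroup.T]

lemma etaQuotient_slash_S
    (hS : ∀ w : ℂ, 0 < w.im → h (-1 / w) = inversionFactor r n w * h w) :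
    etaQuotient r h ∣[((n + n : ℕ) : ℤ)] ModularGroup.S = etaQuotient r h := by
  funext τ
  have hτ := τ.ne_zero
  have hsqrt := sqrtNegI_ne_zero hτ
  have heta := eta_ne_zero τ.im_pos
  have hinv : (-(τ : ℂ))⁻¹ = -1 / τ := by rw [neg_div, one_div, inv_neg]
  rw [SL_slash_apply, ModularGroup.denom_S, modular_S_smul, etaQuotient, etaQuotient,
    UpperHalfPlane.coe_mk, hinv, hS τ τ.im_pos, eta_neg_one_div τ.im_pos, inversionFactor_eq,
    zpow_neg, zpow_natCast]
  field_simp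
  ring

theorem exists_modularForm_eq_etaForm (hr : r ≤ 23) (hh : DifferentiableOn ℂ h {z | 0 < z.im})
    (hah : HasExpansion24 a h) (ha : ∀ j, a j ≠ 0 → j ≡ r [MOD 24])
    (hS : ∀ w : ℂ, 0 < w.im → h (-1 / w) = inversionFactor r n w * h w) :
    ∃ F : ModularForm 𝒮ℒ ((n + n : ℕ) : ℤ), ∀ τ : ℍ, h τ = etaForm r F τ := by
  have hle (j : ℕ) (hj : a j ≠ 0) : r ≤ j :=
    (Nat.mod_eq_of_lt (by lia : r < 24)) ▸ (ha j hj) ▸ Nat.mod_le j 24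
  have hslash := SlashInvariantForm.slash_action_generators_SL2Z (etaQuotient_slash_S hS)
    (etaQuotient_slash_T _ fun w hw => hah.add_one ha hw)
  let F : ModularForm 𝒮ℒ ((n + n : ℕ) : ℤ) :=
    { toFun := etaQuotient r h
      slash_action_eq' := by
        rintro _ ⟨γ, rfl⟩
        exact hslash γ
      holo' := mdifferentiable_etaQuotient r hh
      bdd_at_cusps' := fun hc => by
        rw [OnePoint.isBoundedAt_iff_forall_SL2Z hc]
        intro γ _
        rw [hslash]
        exact isBoundedAtImInfty_etaQuotient hah hle }
  exact ⟨F, fun τ => (eta_pow_mul_etaQuotient r h τ).symm⟩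

end EtaQuotient

section HeckeImage

lemma differentiableOn_shiftSum {c : ℕ} [NeZero c] (hh : DifferentiableOn ℂ h {z | 0 < z.im}) :
    DifferentiableOn ℂ (shiftSum c h) {z | 0 < z.im} :=
  DifferentiableOn.fun_sum fun b _ =>
    hh.comp (by fun_prop) fun _ hz => im_add_div_pos c hz b.val

lemma differentiableOn_charShiftSum {c : ℕ} [NeZero c] (ψ : MulChar (ZMod c) ℂ)
    (hh : DifferentiableOn ℂ h {z | 0 < z.im}) :
    DifferentiableOn ℂ (charShiftSum ψ h) {z | 0 < z.im} :=
  DifferentiableOn.fun_sum fun v _ =>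
    (hh.comp (by fun_prop) fun _ hz => im_add_div_pos c hz v.val).const_mul (ψ v)

variable [Fact ℓ.Prime]

lemma differentiableOn_heckeSum (k : ℕ) (hh : DifferentiableOn ℂ h {z | 0 < z.im}) :
    DifferentiableOn ℂ (heckeSum k ℓ h) {z | 0 < z.im} := by
  have hdil : DifferentiableOn ℂ (fun w => h (ℓ ^ 2 * w)) {z | 0 < z.im} := by
    refine hh.comp (by fun_prop) fun z hz => ?_
    exact_mod_cast im_natCast_mul_pos (ℓ ^ 2) hz
  have htwist : DifferentiableOn ℂ (fun w => charShiftSum (legendreChar ℓ) h (ℓ * w))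
      {z | 0 < z.im} :=
    (differentiableOn_charShiftSum _ hh).comp (by fun_prop) fun _ hz => im_natCast_mul_pos ℓ hz
  exact (((differentiableOn_shiftSum hh).const_mul _).add (htwist.const_mul _)).add
    (hdil.const_mul _)

lemma hasSum_hecke (k : ℕ) (hr : r ≠ 0) (hℓ : 3 < ℓ) (F : ModularForm 𝒮ℒ (m : ℤ)) (τ : ℍ) :
    HasSum (fun n : ℕ => heckeCoeff k chi12 ℓ (fun τ => etaForm r F (mul24 τ)) n *
      cexp (2 * Real.pi * I * (τ : ℂ)) ^ n)
      (heckeSum k ℓ (fun w => etaForm r F (ofComplex w)) (mul24 τ)) := by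
  refine (hasExpansion24_heckeSum k hℓ (hasExpansion24_etaForm hr F) _
    (mul24 τ).im_pos).congr_fun fun n => ?_
  rw [← Complex.exp_nat_mul, coe_mul24]
  congr 2
  ring

lemma hecke_mem_etaSpace (hr : Odd r) (hr_le : r ≤ 23) (hm : Even m) (hℓ : 3 < ℓ)
    (hk : 2 * k + 1 = r + 2 * m) {g : ℍ → ℂ} (hg : g ∈ etaSpace r m) :
    hecke k chi12 ℓ g ∈ etaSpace r m := by
  obtain ⟨n, rfl⟩ := hm
  obtain ⟨F, hF⟩ := hg
  obtain rfl : g = fun τ => etaForm r F (mul24 τ) := funext hF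
  have hr0 : r ≠ 0 := hr.pos.ne'
  have hdiff := UpperHalfPlane.mdifferentiable_iff.mp (mdifferentiable_etaForm (r := r) F)
  obtain ⟨G, hG⟩ := exists_modularForm_eq_etaForm hr_le (differentiableOn_heckeSum k hdiff)
    (hasExpansion24_heckeSum k hℓ (hasExpansion24_etaForm hr0 F))
    (fun j hj => heckeCoeff_modEq hℓ (fun i hi => qCoeff_etaForm_modEq hr0 F hi) hj)
    (fun w hw => (etaTransforms_etaForm hr F).heckeSum_neg_one_div hr hℓ (by lia) hw)
  exact ⟨G, fun τ => (hasSum_hecke k hr0 hℓ F τ).tsum_eq.trans (hG (mul24 τ))⟩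

lemma summable_hecke (k : ℕ) (hr : r ≠ 0) (hℓ : 3 < ℓ) {g : ℍ → ℂ} (hg : g ∈ etaSpace r m)
    (τ : ℍ) :
    Summable fun n : ℕ => heckeCoeff k chi12 ℓ g n * cexp (2 * Real.pi * I * (τ : ℂ)) ^ n := by
  obtain ⟨F, hF⟩ := hg
  obtain rfl : g = fun τ => etaForm r F (mul24 τ) := funext hF
  exact (hasSum_hecke k hr hℓ F τ).summable

end HeckeImage

end HeckeStable

end HalfIntegral

theorem proposition3p1_general (r m k ℓ : ℕ) [Fact ℓ.Prime] (hr : Odd r) (hr_le : r ≤ 23)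
    (hm : Even m) (hℓ : 3 < ℓ) (hk : 2 * k + 1 = r + 2 * m) :
    HalfIntegral.etaSpace r m ≤ HalfIntegral.cuspForms k 576 HalfIntegral.chi12 ∧
    (∀ g ∈ HalfIntegral.etaSpace r m,
      HalfIntegral.hecke k HalfIntegral.chi12 ℓ g ∈ HalfIntegral.etaSpace r m) ∧
    (∀ g ∈ HalfIntegral.etaSpace r m, ∀ τ : UpperHalfPlane,
      Summable fun n : ℕ => HalfIntegral.heckeCoeff k HalfIntegral.chi12 ℓ g n *
        Complex.exp (2 * Real.pi * Complex.I * (τ : ℂ)) ^ n) :=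
  ⟨HalfIntegral.etaSpace_le_cuspForms hr hm hk,
    fun _ hg => HalfIntegral.hecke_mem_etaSpace hr hr_le hm hℓ hk hg,
    fun _ hg => HalfIntegral.summable_hecke k hr.pos.ne' hℓ hg⟩

/-- Here `k + 1/2 = r/2 + m`. The last conjunct says that the series which defines `g ∣ T(ℓ²)`
converges on the upper half-plane. -/
theorem proposition3p1 (r m k ℓ : ℕ) [Fact ℓ.Prime] (hr₁ : 1 ≤ r) (hr₂ : r ≤ 23)
    (hr₃ : Nat.Coprime r 6) (hm : Even m) (hℓ : 3 < ℓ) (hk : 2 * k + 1 = r + 2 * m) :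
    HalfIntegral.etaSpace r m ≤ HalfIntegral.cuspForms k 576 HalfIntegral.chi12 ∧
    (∀ g ∈ HalfIntegral.etaSpace r m,
      HalfIntegral.hecke k HalfIntegral.chi12 ℓ g ∈ HalfIntegral.etaSpace r m) ∧
    (∀ g ∈ HalfIntegral.etaSpace r m, ∀ τ : UpperHalfPlane,
      Summable fun n : ℕ => HalfIntegral.heckeCoeff k HalfIntegral.chi12 ℓ g n *
        Complex.exp (2 * Real.pi * Complex.I * (τ : ℂ)) ^ n) := by
  have hr : Odd r := (Nat.Coprime.coprime_dvd_right (by norm_num : 2 ∣ 6) hr₃).odd_of_right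
  exact proposition3p1_general r m k ℓ hr hr₂ hm hℓ hk
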